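/- Let $(\Sigma,\mu)$ be a $\sigma$-finite measure space and let $\mathbb K\in\{\mathbb R,\mathbb C\}$. Let $X_0,X_1$ be rearrangement invariant (complex) K\"othe function spaces on $(\Sigma,\mu)$, meaning that each $X_j$ and its norm are invariant under the measure preserving automorphisms of $(\Sigma,\mu)$. Let $0<\theta<1$ be such that the complex interpolation space $(X_0,X_1)_\theta$ is $L_2(\mu;\mathbb C)$ with equivalent norms. Let $\mathcal H=\mathcal H(X_0,X_1)$ be Calder\'on's space of functions on the strip $0\le\mathrm{Re}\,z\le 1$: functions with values in $X_0+X_1$ that are bounded and continuous on the closed strip and analytic inside it, and whose restrictions to the lines $\mathrm{Re}\,z=j$ are bounded and continuous into $X_j$, $j=0,1$; its norm is $\|g\|_{\mathcal H}=\sup\{\|g(j+it)\|_{X_j}: j=0,1,\ t\in\mathbb R\}$. Let $\Omega:L_2(\mu;\mathbb K)\to L_0(\mu;\mathbb K)$ be induced by the scale: $\Omega x=(Bx)'(\theta)$ for some bounded $\mathbb K$-homogeneous map $B:L_2(\mu;\mathbb K)\to\mathcal H$ with $(Bx)(\theta)=x$ for all $x$. (When $\mathbb K=\mathbb R$ it is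 understood that all $(Bx)'(\theta)$ are real functions.) Then $\Omega$ is an $L_\infty$-centralizer on $L_2(\mu;\mathbb K)$. Let $$d_\Omega L_2=\{(w,x): w\in L_0,\ x\in L_2,\ w-\Omega x\in L_2\},\qquad \|(w,x)\|=\|x\|_2+\|w-\Omega x\|_2,$$ with inclusion $j(y)=(y,0)$ and quotient map $q(w,x)=x$. Let $(\Sigma_n)_{n\ge1}$ be a partition of $\Sigma$, up to a null set, into measurable sets of positive measure, let $\sigma=(1\,2)(3\,4)(5\,6)\cdots$, and let $a_n:\Sigma_n\to\Sigma_{\sigma(n)}$ be measure preserving bijections with $a_{\sigma(n)}=a_n^{-1}$. Let $$\omega(f)=\sum_n(-1)^n\,(f|_{\Sigma_{\sigma(n)}}\circ a_n)\,1_{\Sigma_n}$$ be the corresponding natural complex structure on $L_2(\mu;\mathbb K)$. Then $\omega^2=-\mathrm{id}$, and $d_\Omega L_2$ admits a complex structure compatible with $\omega$: there is a bounded $\mathbb K$-linear operator $\beta$ on $d_\Omega L_2$ with $\beta^2=-\mathrm{id}$, $\beta j=j\omega$ and $q\beta=\omega q$. Moreover, such partitions exist on $[0,1]$ and on $[0,\infty)$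 with Lebesgue measure, and on $\mathbb N$ with counting measure. Hence on these measure spaces every twisted sum $d_\Omega L_2$ induced by a centralizer coming from an interpolation scale of rearrangement invariant K\"othe function spaces admits a complex structure compatible with a natural complex structure on $L_2$. -/

import Mathlib

open MeasureTheory Filter Topology
open scoped ENNReal NNReal

noncomputable section

namespace TwistedHilbert

/-! ### Köthe function spaces -/

/-- A (complex) Köthe function space over `μ`, given by its norm on `L₀(μ; ℂ)`, with the
convention that the norm is `∞` exactly at the functions that do not belong to the space. -/
structure KotheSpace {α : Type*} [MeasurableSpace α] (μ : Measure α) where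
  /-- the norm; `f` belongs to the space when `N f < ∞` -/
  N : (α →ₘ[μ] ℂ) → ℝ≥0∞
  eq_zero_iff : ∀ f, N f = 0 ↔ f = 0
  add_le : ∀ f g, N (f + g) ≤ N f + N g
  smul_eq : ∀ (c : ℂ) f, N (c • f) = ‖c‖ₑ * N f
  /-- the space is a Banach space -/
  complete : ∀ f : ℕ → (α →ₘ[μ] ℂ), (∀ n, N (f n) < ∞) →
    (∀ ε : ℝ≥0∞, 0 < ε → ∃ M, ∀ m ≥ M, ∀ n ≥ M, N (f m - f n) < ε) →
    ∃ g, N g < ∞ ∧ Tendsto (fun n => N (f n - g)) atTop (𝓝 0)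
  /-- ideal property and monotonicity of the norm -/
  mono : ∀ f g : α →ₘ[μ] ℂ, (∀ᵐ x ∂μ, ‖f x‖ ≤ ‖g x‖) → N f ≤ N g
  /-- the space contains the characteristic functions of sets of finite measure -/
  indicator_mem : ∀ (A : Set α) (hA : MeasurableSet A), μ A < ∞ →
    N (AEEqFun.mk (A.indicator fun _ => (1 : ℂ))
      (aestronglyMeasurable_const.indicator hA)) < ∞
  /-- the space consists of locally integrable functions -/
  integrableOn : ∀ f : α →ₘ[μ] ℂ, N f < ∞ →
    ∀ A : Set α, MeasurableSet A → μ A < ∞ → IntegrableOn f A μ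

/-- Rearrangement invariance: the space and its norm are invariant under the measure preserving
automorphisms of the underlying measure space. -/
def KotheSpace.RearrangementInvariant {α : Type*} [MeasurableSpace α] {μ : Measure α}
    (X : KotheSpace μ) : Prop :=
  ∀ (τ : α ≃ᵐ α) (hτ : MeasurePreserving τ μ μ) (f : α →ₘ[μ] ℂ),
    X.N (f.compMeasurePreserving τ hτ) = X.N f

/-! ### Complex interpolation of a couple of Köthe spaces -/

section Interpolation

variable {α : Type*} [MeasurableSpace α] {μ : Measure α} (X₀ X₁ : KotheSpace μ)

/-- The norm of the sum space `X₀ + X₁` (equal to `∞` off the sum space). -/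
def sumNorm (x : α →ₘ[μ] ℂ) : ℝ≥0∞ :=
  ⨅ (x₀ : α →ₘ[μ] ℂ) (x₁ : α →ₘ[μ] ℂ) (_ : x₀ + x₁ = x), X₀.N x₀ + X₁.N x₁

/-- The closed strip `0 ≤ Re z ≤ 1`. -/
def strip : Set ℂ := {z | 0 ≤ z.re ∧ z.re ≤ 1}

/-- The open strip `0 < Re z < 1`. -/
def openStrip : Set ℂ := {z | 0 < z.re ∧ z.re < 1}

/-- `v` is the complex derivative of `g` at `z` for the norm of `X₀ + X₁`. -/
def HasSumDerivAt (g : ℂ → α →ₘ[μ] ℂ) (v : α →ₘ[μ] ℂ) (z : ℂ) : Prop :=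
  Tendsto (fun w => sumNorm X₀ X₁ ((w - z)⁻¹ • (g w - g z) - v)) (𝓝[≠] z) (𝓝 0)

/-- Calderón's space `ℋ(X₀, X₁)`. Only the values of `g` on the closed strip matter. -/
structure MemCalderon (g : ℂ → α →ₘ[μ] ℂ) : Prop where
  bounded : ∃ C : ℝ≥0, ∀ z ∈ strip, sumNorm X₀ X₁ (g z) ≤ C
  continuousOn : ∀ z ∈ strip,
    Tendsto (fun w => sumNorm X₀ X₁ (g w - g z)) (𝓝[strip] z) (𝓝 0)
  analytic : ∀ z ∈ openStrip, ∃ v, HasSumDerivAt X₀ X₁ g v z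
  bounded_zero : ∃ C : ℝ≥0, ∀ t : ℝ, X₀.N (g (Complex.I * t)) ≤ C
  continuous_zero : ∀ t : ℝ,
    Tendsto (fun s : ℝ => X₀.N (g (Complex.I * s) - g (Complex.I * t))) (𝓝 t) (𝓝 0)
  bounded_one : ∃ C : ℝ≥0, ∀ t : ℝ, X₁.N (g (Complex.I * t + 1)) ≤ C
  continuous_one : ∀ t : ℝ,
    Tendsto (fun s : ℝ => X₁.N (g (Complex.I * s + 1) - g (Complex.I * t + 1))) (𝓝 t) (𝓝 0)

/-- The norm of Calderón's space. -/
def calderonNorm (g : ℂ → α →ₘ[μ] ℂ) : ℝ≥0∞ :=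
  max (⨆ t : ℝ, X₀.N (g (Complex.I * t))) (⨆ t : ℝ, X₁.N (g (Complex.I * t + 1)))

/-- The norm of the complex interpolation space `X_θ = (X₀, X₁)_θ` (equal to `∞` off `X_θ`). -/
def interpNorm (θ : ℝ) (x : α →ₘ[μ] ℂ) : ℝ≥0∞ :=
  ⨅ (g : ℂ → α →ₘ[μ] ℂ) (_ : MemCalderon X₀ X₁ g) (_ : g θ = x), calderonNorm X₀ X₁ g

/-- `(X₀, X₁)_θ = L₂(μ; ℂ)`, with equivalence of norms. -/
def InterpolatesToL2 (θ : ℝ) : Prop :=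
  ∃ C : ℝ≥0, ∀ x : α →ₘ[μ] ℂ,
    interpNorm X₀ X₁ θ x ≤ C * eLpNorm x 2 μ ∧ eLpNorm x 2 μ ≤ C * interpNorm X₀ X₁ θ x

/-- The canonical map `L₀(μ; 𝕜) → L₀(μ; ℂ)`: the identity for `𝕜 = ℂ`, and the inclusion of the
real functions for `𝕜 = ℝ`. -/
def toComplexFun {𝕜 : Type*} [RCLike 𝕜] (f : α →ₘ[μ] 𝕜) : α →ₘ[μ] ℂ :=
  f.comp (RCLike.map 𝕜 ℂ) (RCLike.map 𝕜 ℂ).continuous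

/-- `Ω = δ'_θ B` for some bounded homogeneous selection `B` of the evaluation map `δ_θ`. For
`𝕜 = ℂ` this is the centralizer `Ω_θ` of the couple; for `𝕜 = ℝ` it is its version on the real
space `L₂`, for a selection with respect to which `Ω_θ` maps real functions to real functions. -/
def IsInducedByScale {𝕜 : Type*} [RCLike 𝕜] (θ : ℝ)
    (Ω : Lp 𝕜 2 μ → (α →ₘ[μ] 𝕜)) : Prop :=
  ∃ B : Lp 𝕜 2 μ → ℂ → (α →ₘ[μ] ℂ),
    (∀ x, MemCalderon X₀ X₁ (B x)) ∧
    (∃ C : ℝ≥0, ∀ x, calderonNorm X₀ X₁ (B x) ≤ C * ‖x‖ₑ) ∧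
    (∀ (c : 𝕜) x, ∀ z ∈ strip, B (c • x) z = RCLike.map 𝕜 ℂ c • B x z) ∧
    (∀ x, B x θ = toComplexFun (x : α →ₘ[μ] 𝕜)) ∧
    (∀ x, HasSumDerivAt X₀ X₁ (B x) (toComplexFun (Ω x)) θ)

end Interpolation

/-! ### Centralizers on `L₂` and the twisted sum `d_Ω L₂` -/

section TwistedSum

variable {α : Type*} [MeasurableSpace α] {μ : Measure α} {𝕜 : Type*} [RCLike 𝕜]

/-- `Ω : L₂ → L₀` is an `L_∞`-centralizer on `L₂`. -/
structure IsCentralizer (Ω : Lp 𝕜 2 μ → (α →ₘ[μ] 𝕜)) : Prop where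
  homogeneous : ∀ (c : 𝕜) x, Ω (c • x) = c • Ω x
  quasilinear : ∃ C : ℝ, ∀ x y, ∃ v : Lp 𝕜 2 μ,
    (v : α →ₘ[μ] 𝕜) = Ω (x + y) - Ω x - Ω y ∧ ‖v‖ ≤ C * (‖x‖ + ‖y‖)
  centralizer : ∃ C : ℝ, ∀ (f : Lp 𝕜 ∞ μ) (x y : Lp 𝕜 2 μ),
    (y : α →ₘ[μ] 𝕜) = (f : α →ₘ[μ] 𝕜) * (x : α →ₘ[μ] 𝕜) →
    ∃ v : Lp 𝕜 2 μ, (v : α →ₘ[μ] 𝕜) = Ω y - (f : α →ₘ[μ] 𝕜) * Ω x ∧ ‖v‖ ≤ C * ‖f‖ * ‖x‖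

/-- The twisted sum `d_Ω L₂ = {(w, x) : w ∈ L₀, x ∈ L₂, w - Ω x ∈ L₂}`. -/
def twistedSum (Ω : Lp 𝕜 2 μ → (α →ₘ[μ] 𝕜)) (hΩ : IsCentralizer Ω) :
    Submodule 𝕜 ((α →ₘ[μ] 𝕜) × Lp 𝕜 2 μ) where
  carrier := {p | p.1 - Ω p.2 ∈ Lp 𝕜 2 μ}
  zero_mem' := by
    have h : Ω 0 = 0 := by
      have h0 := hΩ.homogeneous 0 0
      exact (zero_smul 𝕜 (0 : Lp 𝕜 2 μ) ▸ h0).trans (zero_smul 𝕜 (Ω 0))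
    simp [h]
  add_mem' := by
    intro p q hp hq
    obtain ⟨C, hC⟩ := hΩ.quasilinear
    obtain ⟨v, hv, -⟩ := hC p.2 q.2
    have h : (p + q).1 - Ω (p + q).2 = (p.1 - Ω p.2) + (q.1 - Ω q.2) - v := by
      rw [hv, Prod.fst_add, Prod.snd_add]; abel
    show (p + q).1 - Ω (p + q).2 ∈ Lp 𝕜 2 μ
    rw [h]
    exact sub_mem (add_mem hp hq) v.2
  smul_mem' := by
    intro c p hp
    show (c • p).1 - Ω (c • p).2 ∈ Lp 𝕜 2 μ
    have h : (c • p).1 - Ω (c • p).2 = c • (p.1 - Ω p.2) := by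
      rw [Prod.smul_fst, Prod.smul_snd, hΩ.homogeneous, smul_sub]
    rw [h]
    exact Lp.const_smul_mem_Lp c ⟨_, hp⟩

/-- The quasi-norm `‖(w, x)‖ = ‖x‖ + ‖w - Ω x‖` of `d_Ω L₂`. -/
def twistedNorm (Ω : Lp 𝕜 2 μ → (α →ₘ[μ] 𝕜)) (hΩ : IsCentralizer Ω)
    (p : twistedSum Ω hΩ) : ℝ :=
  ‖p.1.2‖ + ‖(⟨p.1.1 - Ω p.1.2, p.2⟩ : Lp 𝕜 2 μ)‖

/-- The inclusion `j : L₂ → d_Ω L₂`, `j y = (y, 0)`. -/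
def twistedIncl (Ω : Lp 𝕜 2 μ → (α →ₘ[μ] 𝕜)) (hΩ : IsCentralizer Ω) (y : Lp 𝕜 2 μ) :
    twistedSum Ω hΩ :=
  ⟨((y : α →ₘ[μ] 𝕜), 0), by
    have h : Ω 0 = 0 := by
      have h0 := hΩ.homogeneous 0 0
      exact (zero_smul 𝕜 (0 : Lp 𝕜 2 μ) ▸ h0).trans (zero_smul 𝕜 (Ω 0))
    show (y : α →ₘ[μ] 𝕜) - Ω 0 ∈ Lp 𝕜 2 μ
    rw [h, sub_zero]
    exact y.2⟩

/-- The quotient map `q : d_Ω L₂ → L₂`, `q (w, x) = x`. -/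
def twistedQuot (Ω : Lp 𝕜 2 μ → (α →ₘ[μ] 𝕜)) (hΩ : IsCentralizer Ω)
    (p : twistedSum Ω hΩ) : Lp 𝕜 2 μ := p.1.2

end TwistedSum

/-! ### The natural complex structure on `L₂` -/

/-- The permutation `(0 1)(2 3)(4 5)⋯` of `ℕ`. -/
def swap (n : ℕ) : ℕ := if Even n then n + 1 else n - 1

lemma swap_swap (n : ℕ) : swap (swap n) = n := by
  unfold swap
  by_cases h : Even n
  · simp [h, Nat.even_add_one]
  · have h1 : Even (n - 1) := by
      have := Nat.not_even_iff_odd.1 h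
      obtain ⟨k, rfl⟩ := this
      simp
    have h0 : n ≠ 0 := by rintro rfl; simp at h
    simp [h, h1]
    omega

/-- A partition `(Σ_n)` of the measure space (up to a null set) into sets of positive measure,
with measure preserving bijections `a_n : Σ_n → Σ_{swap n}`, where `a_{swap n}` is the inverse
of `a_n`. (The `a_n` are extended arbitrarily to measurable maps on the whole space.) -/
structure PairedPartition {α : Type*} [MeasurableSpace α] (μ : Measure α) where
  part : ℕ → Set α
  a : ℕ → α → α
  measurableSet_part : ∀ n, MeasurableSet (part n)
  measure_pos : ∀ n, 0 < μ (part n)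
  disjoint : Pairwise (Function.onFun Disjoint part)
  cover : ∀ᵐ x ∂μ, ∃ n, x ∈ part n
  mapsTo : ∀ n, Set.MapsTo (a n) (part n) (part (swap n))
  leftInv : ∀ n, Set.LeftInvOn (a (swap n)) (a n) (part n)
  measurePreserving : ∀ n,
    MeasurePreserving (a n) (μ.restrict (part n)) (μ.restrict (part (swap n)))

namespace PairedPartition

variable {α : Type*} [MeasurableSpace α] {μ : Measure α} (S : PairedPartition μ)

open Classical in
/-- The map equal to `a_n` on `Σ_n`, and to the identity off the `Σ_n`. -/
def flip (x : α) : α := if h : ∃ n, x ∈ S.part n then S.a h.choose x else x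

open Classical in
/-- The function equal to `(-1)^n` on the `n`-th set of the partition, counting from `1`. -/
def sign (𝕜 : Type*) [RCLike 𝕜] (x : α) : 𝕜 :=
  if h : ∃ n, x ∈ S.part n then (-1) ^ (h.choose + 1) else 1

lemma index_unique {x : α} {m n : ℕ} (hm : x ∈ S.part m) (hn : x ∈ S.part n) : m = n := by
  by_contra h
  exact Set.disjoint_left.1 (S.disjoint h) hm hn

lemma flip_of_mem {x : α} {n : ℕ} (hn : x ∈ S.part n) : S.flip x = S.a n x := by
  have h : ∃ n, x ∈ S.part n := ⟨n, hn⟩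
  rw [flip, dif_pos h, S.index_unique h.choose_spec hn]

lemma sign_of_mem (𝕜 : Type*) [RCLike 𝕜] {x : α} {n : ℕ} (hn : x ∈ S.part n) :
    S.sign 𝕜 x = (-1) ^ (n + 1) := by
  have h : ∃ n, x ∈ S.part n := ⟨n, hn⟩
  rw [sign, dif_pos h, S.index_unique h.choose_spec hn]

lemma measurable_a (n : ℕ) : Measurable (S.a n) := (S.measurePreserving n).measurable

lemma measurable_flip : Measurable S.flip := by
  intro s hs
  have : S.flip ⁻¹' s = (⋃ n, S.part n ∩ S.a n ⁻¹' s) ∪ ((⋃ n, S.part n)ᶜ ∩ s) := by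
    ext x
    by_cases h : ∃ n, x ∈ S.part n
    · obtain ⟨n, hn⟩ := h
      simp only [Set.mem_preimage, S.flip_of_mem hn, Set.mem_union, Set.mem_iUnion, Set.mem_inter_iff,
        Set.mem_compl_iff]
      constructor
      · exact fun h => Or.inl ⟨n, hn, h⟩
      · rintro (⟨m, hm, h⟩ | ⟨h, -⟩)
        · rwa [← S.index_unique hm hn]
        · exact absurd ⟨n, hn⟩ h
    · have h' : S.flip x = x := by rw [flip, dif_neg h]
      simp only [Set.mem_preimage, h', Set.mem_union, Set.mem_iUnion, Set.mem_inter_iff,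
        Set.mem_compl_iff, h, not_false_iff, true_and]
      constructor
      · exact Or.inr
      · rintro (⟨m, hm, -⟩ | h1)
        · exact absurd ⟨m, hm⟩ h
        · exact h1
  rw [this]
  refine (MeasurableSet.iUnion fun n => (S.measurableSet_part n).inter (S.measurable_a n hs)).union
    ((MeasurableSet.iUnion S.measurableSet_part).compl.inter hs)

lemma measure_eq_sum : Measure.sum (fun n => μ.restrict (S.part n)) = μ := by
  rw [← Measure.restrict_iUnion S.disjoint S.measurableSet_part,
    Measure.restrict_eq_self_of_ae_mem]
  filter_upwards [S.cover] with x hx using Set.mem_iUnion.2 hx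

lemma measurePreserving_flip : MeasurePreserving S.flip μ μ := by
  refine ⟨S.measurable_flip, ?_⟩
  have h1 : ∀ n, (μ.restrict (S.part n)).map S.flip = μ.restrict (S.part (swap n)) := by
    intro n
    rw [← (S.measurePreserving n).map_eq]
    refine Measure.map_congr ?_
    filter_upwards [ae_restrict_mem (S.measurableSet_part n)] with x hx using S.flip_of_mem hx
  have hinv : Function.Involutive swap := swap_swap
  have h2 : Measure.sum (fun n => μ.restrict (S.part (swap n)))
      = Measure.sum (fun n => μ.restrict (S.part n)) := by
    ext s hs
    rw [Measure.sum_apply _ hs, Measure.sum_apply _ hs]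
    exact (hinv.toPerm).tsum_eq (fun n => μ.restrict (S.part n) s)
  calc μ.map S.flip = (Measure.sum fun n => μ.restrict (S.part n)).map S.flip :=
        congrArg (fun ν : Measure α => ν.map S.flip) S.measure_eq_sum.symm
    _ = μ := by
        rw [Measure.map_sum S.measurable_flip.aemeasurable]
        simp only [h1]
        rw [h2, S.measure_eq_sum]

lemma norm_sign (𝕜 : Type*) [RCLike 𝕜] (x : α) : ‖S.sign 𝕜 x‖ = 1 := by
  unfold sign
  split_ifs <;> simp

lemma measurable_sign (𝕜 : Type*) [RCLike 𝕜] : StronglyMeasurable (S.sign 𝕜) := by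
  refine Measurable.stronglyMeasurable ?_
  intro s _
  have : S.sign 𝕜 ⁻¹' s = (⋃ n, S.part n ∩ {_x | (-1 : 𝕜) ^ (n + 1) ∈ s}) ∪
      ((⋃ n, S.part n)ᶜ ∩ {_x | (1 : 𝕜) ∈ s}) := by
    ext x
    by_cases h : ∃ n, x ∈ S.part n
    · obtain ⟨n, hn⟩ := h
      simp only [Set.mem_preimage, S.sign_of_mem 𝕜 hn, Set.mem_union, Set.mem_iUnion,
        Set.mem_inter_iff, Set.mem_compl_iff, Set.mem_ofPred_eq]
      constructor
      · exact fun h => Or.inl ⟨n, hn, h⟩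
      · rintro (⟨m, hm, h⟩ | ⟨h, -⟩)
        · rwa [← S.index_unique hm hn]
        · exact absurd ⟨n, hn⟩ h
    · have h' : S.sign 𝕜 x = 1 := by rw [sign, dif_neg h]
      simp only [Set.mem_preimage, h', Set.mem_union, Set.mem_iUnion, Set.mem_inter_iff,
        Set.mem_compl_iff, h, not_false_iff, true_and, Set.mem_ofPred_eq]
      constructor
      · exact Or.inr
      · rintro (⟨m, hm, -⟩ | h1)
        · exact absurd ⟨m, hm⟩ h
        · exact h1
  rw [this]
  exact (MeasurableSet.iUnion fun n => (S.measurableSet_part n).inter (MeasurableSet.const _)).union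
    ((MeasurableSet.iUnion S.measurableSet_part).compl.inter (MeasurableSet.const _))

lemma memLp_rotate {𝕜 : Type*} [RCLike 𝕜] (f : Lp 𝕜 2 μ) :
    MemLp (fun x => S.sign 𝕜 x * f (S.flip x)) 2 μ := by
  have h := (Lp.memLp f).comp_measurePreserving S.measurePreserving_flip
  refine h.of_le ((S.measurable_sign 𝕜).aestronglyMeasurable.mul h.1) ?_
  filter_upwards with x
  simp [S.norm_sign 𝕜 x]

/-- The natural complex structure `ω` on `L₂` attached to the partition:
`ω f = ∑ (-1)^n (f|_{Σ_{swap n}} ∘ a_n) 1_{Σ_n}`, the sets being counted from `n = 1`. -/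
def omega (𝕜 : Type*) [RCLike 𝕜] : Lp 𝕜 2 μ →L[𝕜] Lp 𝕜 2 μ :=
  LinearMap.mkContinuous
    { toFun := fun f => (S.memLp_rotate f).toLp _
      map_add' := by
        intro f g
        rw [← MemLp.toLp_add, MemLp.toLp_eq_toLp_iff]
        have h := S.measurePreserving_flip.quasiMeasurePreserving.ae (Lp.coeFn_add f g)
        filter_upwards [h] with x hx
        simp only [Pi.add_apply] at hx ⊢
        rw [hx, mul_add]
      map_smul' := by
        intro c f
        rw [RingHom.id_apply, ← MemLp.toLp_const_smul, MemLp.toLp_eq_toLp_iff]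
        have h := S.measurePreserving_flip.quasiMeasurePreserving.ae (Lp.coeFn_smul c f)
        filter_upwards [h] with x hx
        simp [hx, mul_left_comm] }
    1 (by
      intro f
      have h := Lp.norm_compMeasurePreserving f S.measurePreserving_flip
      rw [one_mul, ← h]
      refine Lp.norm_le_norm_of_ae_le ?_
      filter_upwards [(S.memLp_rotate f).coeFn_toLp,
        Lp.coeFn_compMeasurePreserving f S.measurePreserving_flip] with x h1 h2
      change ‖(S.memLp_rotate f).toLp _ x‖ ≤ _
      rw [h1, h2]
      simp [S.norm_sign 𝕜 x])

end PairedPartition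

end TwistedHilbert

end

noncomputable section

namespace TwistedHilbert

/-! ### Elementary properties of Köthe norms -/

namespace KotheSpace

variable {α : Type*} [MeasurableSpace α] {μ : Measure α} (X : KotheSpace μ)

/-! The engine is the commutator principle of complex interpolation. If `g` lies in Calderón's space
and `g θ = 0`, then `g(z)/(z - θ)` also lies there, with norm larger by a factor at most `1 / min(θ,
1 - θ)`, because that minimum is the distance from `θ` to the boundary lines. The value of the
quotient at `θ` is `g'(θ)`, so `g'(θ)` belongs to `X_θ = L₂` with control of its norm
(`MemCalderon.exists_div`, `InterpolatesToL2.exists_eLpNorm_le`).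

This is applied to functions built from the selection `B` that vanish at `θ`. The function `B(x + y)
- Bx - By` has derivative `Ω(x + y) - Ωx - Ωy`, which gives quasilinearity. If `T` is linear and
bounded on both `X₀` and `X₁`, then `B(Tx) - T(Bx)` has derivative `ΩTx - TΩx`, so `T` and `Ω`
commute up to a bounded map (`IsInducedByScale.exists_commutator`). Multiplication by a bounded
function gives the centralizer estimate. The operator `ω` is composition with a measure preserving
involution followed by multiplication by signs, so rearrangement invariance makes it bounded on `X₀`
and `X₁`, and it commutes with `Ω` up to a bounded map too. Hence `β(w, x) = (ωw, ωx)` is well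
defined and bounded on the twisted sum, and `β² = -1` is inherited from `ω`.

The division step needs the removable singularity theorem for functions with values in `X₀ + X₁`, so
this space is first shown to be Banach. That its norm is definite rests on the fact that fast norm
convergence in a Köthe space implies convergence almost everywhere. Real scalars are treated by
carrying every estimate to complex functions through `toComplexFun`, which preserves `L₂` norms. -/

lemma N_zero : X.N 0 = 0 := (X.eq_zero_iff 0).2 rfl

lemma N_neg (f : α →ₘ[μ] ℂ) : X.N (-f) = X.N f := by
  rw [← neg_one_smul ℂ f, X.smul_eq]
  simp

lemma N_sub_comm (f g : α →ₘ[μ] ℂ) : X.N (f - g) = X.N (g - f) := by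
  rw [← neg_sub, X.N_neg]

lemma N_sub_le (f g : α →ₘ[μ] ℂ) : X.N (f - g) ≤ X.N f + X.N g := by
  rw [sub_eq_add_neg, ← X.N_neg g]
  exact X.add_le _ _

lemma N_sum_le {ι : Type*} (s : Finset ι) (f : ι → α →ₘ[μ] ℂ) :
    X.N (∑ i ∈ s, f i) ≤ ∑ i ∈ s, X.N (f i) := by
  classical
  induction s using Finset.induction_on with
  | empty => simp [X.N_zero]
  | insert i s hi ih =>
    rw [Finset.sum_insert hi, Finset.sum_insert hi]
    exact (X.add_le _ _).trans (by gcongr)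

/-- Absolutely convergent series converge in a Köthe space. -/
lemma exists_tendsto_sum (f : ℕ → α →ₘ[μ] ℂ) (hf : ∑' n, X.N (f n) ≠ ∞) :
    ∃ g, X.N g < ∞ ∧
      Tendsto (fun n => X.N (∑ i ∈ Finset.range n, f i - g)) atTop (𝓝 0) := by
  refine X.complete _ (fun n => ?_) (fun ε hε => ?_)
  · exact (X.N_sum_le _ _).trans_lt ((ENNReal.sum_le_tsum _).trans_lt hf.lt_top)
  · obtain ⟨M, hM⟩ := ((ENNReal.tendsto_sum_nat_add (fun n => X.N (f n)) hf).eventually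
      (gt_mem_nhds hε)).exists
    have key : ∀ m ≥ M, ∀ n ≥ m,
        X.N (∑ i ∈ Finset.range n, f i - ∑ i ∈ Finset.range m, f i) < ε := by
      intro m hm n hn
      rw [← Finset.sum_Ico_eq_sub _ hn]
      refine ((X.N_sum_le _ _).trans ?_).trans_lt hM
      calc ∑ i ∈ Finset.Ico m n, X.N (f i) ≤ ∑ i ∈ Finset.Ico M n, X.N (f i) :=
            Finset.sum_le_sum_of_subset (Finset.Ico_subset_Ico_left hm)
        _ = ∑ i ∈ Finset.range (n - M), X.N (f (i + M)) := by
            rw [Finset.sum_Ico_eq_sum_range]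
            simp_rw [add_comm M]
        _ ≤ ∑' k, X.N (f (k + M)) := ENNReal.sum_le_tsum _
    refine ⟨M, fun m hm n hn => ?_⟩
    rcases le_total m n with h | h
    · rw [X.N_sub_comm]
      exact key m hm n h
    · exact key n hn m h

/-- A norm limit of an increasing sequence of functions dominates the sequence. -/
lemma ae_re_le_of_tendsto {s : ℕ → α →ₘ[μ] ℂ} {F : α →ₘ[μ] ℂ}
    (hs : ∀ m n, m ≤ n → ∀ᵐ x ∂μ, (s m x).re ≤ (s n x).re)
    (h : Tendsto (fun n => X.N (s n - F)) atTop (𝓝 0)) (n : ℕ) :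
    ∀ᵐ x ∂μ, (s n x).re ≤ (F x).re := by
  have hpos : Continuous fun z : ℂ => ((max z.re 0 : ℝ) : ℂ) := by fun_prop
  let D : α →ₘ[μ] ℂ := (s n - F).comp _ hpos
  have hD : D =ᵐ[μ] fun x => ((max ((s n x).re - (F x).re) 0 : ℝ) : ℂ) := by
    filter_upwards [AEEqFun.coeFn_comp _ hpos (s n - F), AEEqFun.coeFn_sub (s n) F] with x h1 h2
    rw [h1, Function.comp_apply, h2, Pi.sub_apply, Complex.sub_re]
  -- `D` is the positive part of `Re (s n - F)`. For `m ≥ n` it is dominated by `|s m - F|`, whose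
  -- norm tends to `0` as `m` grows.
  have hD0 : X.N D = 0 := by
    refine le_antisymm (ge_of_tendsto h ?_) zero_le
    filter_upwards [eventually_ge_atTop n] with m hm
    refine X.mono _ _ ?_
    filter_upwards [hD, hs n m hm, AEEqFun.coeFn_sub (s m) F] with x h1 h2 h3
    rw [h1, h3, Complex.norm_real, Real.norm_of_nonneg (le_max_right _ _)]
    refine max_le ?_ (norm_nonneg _)
    refine le_trans ?_ (Complex.re_le_norm _)
    rw [Pi.sub_apply, Complex.sub_re]
    linarith
  filter_upwards [hD, (AEEqFun.ext_iff.1 ((X.eq_zero_iff D).1 hD0)), AEEqFun.coeFn_zero (μ := μ)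
    (β := ℂ) (α := α)] with x h1 h2 h3
  rw [h1, h3, Pi.zero_apply, Complex.ofReal_eq_zero] at h2
  linarith [le_max_left ((s n x).re - (F x).re) 0]

/-- A sequence that converges to zero fast enough in norm converges to zero almost everywhere. -/
lemma ae_tendsto_zero (a : ℕ → α →ₘ[μ] ℂ) (ha : ∀ n, X.N (a n) ≤ (4⁻¹ : ℝ≥0∞) ^ n) :
    ∀ᵐ x ∂μ, Tendsto (fun n => a n x) atTop (𝓝 0) := by
  have habs : Continuous fun z : ℂ => ((‖z‖ : ℝ) : ℂ) := by fun_prop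
  -- With the weights `2 ^ n` the series of moduli is still norm summable. Its sum `F` dominates the
  -- partial sums, so `|a n| ≤ 2⁻ⁿ Re F` almost everywhere.
  let f : ℕ → α →ₘ[μ] ℂ := fun n => (2 ^ n : ℂ) • (a n).comp _ habs
  have hf : ∀ n, f n =ᵐ[μ] fun x => ((2 ^ n * ‖a n x‖ : ℝ) : ℂ) := by
    intro n
    filter_upwards [AEEqFun.coeFn_smul (2 ^ n : ℂ) ((a n).comp _ habs),
      AEEqFun.coeFn_comp _ habs (a n)] with x h1 h2
    rw [h1, Pi.smul_apply, h2]
    simp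
  have hfN : ∀ n, X.N (f n) ≤ (2⁻¹ : ℝ≥0∞) ^ n := by
    intro n
    have h1 : X.N (f n) ≤ X.N ((2 ^ n : ℂ) • a n) := by
      refine X.mono _ _ ?_
      filter_upwards [hf n, AEEqFun.coeFn_smul (2 ^ n : ℂ) (a n)] with x h1 h2
      rw [h1, h2]
      simp
    refine h1.trans ?_
    rw [X.smul_eq]
    have h2 : ‖(2 ^ n : ℂ)‖ₑ = 2 ^ n := by
      rw [enorm_pow, ← ofReal_norm]
      simp
    have h4 : (4⁻¹ : ℝ≥0∞) = 2⁻¹ * 2⁻¹ := by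
      rw [← ENNReal.mul_inv (by simp) (by simp)]
      norm_num
    calc _ ≤ (2 : ℝ≥0∞) ^ n * (4⁻¹) ^ n := by rw [h2]; gcongr; exact ha n
      _ = 2⁻¹ ^ n := by
        rw [← mul_pow, h4, ← mul_assoc, ENNReal.mul_inv_cancel (by simp) (by simp), one_mul]
  have hsum : ∑' n, X.N (f n) ≠ ∞ := by
    refine ((ENNReal.tsum_le_tsum hfN).trans_lt ?_).ne
    rw [ENNReal.tsum_geometric]
    simp
  obtain ⟨F, -, hF⟩ := X.exists_tendsto_sum f hsum
  have hS : ∀ᵐ x ∂μ, ∀ n, (((∑ i ∈ Finset.range n, f i : α →ₘ[μ] ℂ) : α → ℂ) x).re =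
      ∑ i ∈ Finset.range n, 2 ^ i * ‖a i x‖ := by
    rw [ae_all_iff]
    intro n
    induction n with
    | zero =>
      filter_upwards [AEEqFun.coeFn_zero (μ := μ) (β := ℂ) (α := α)] with x h
      simp [h]
    | succ n ih =>
      filter_upwards [ih, hf n, AEEqFun.coeFn_add (∑ i ∈ Finset.range n, f i) (f n)] with x h1 h2 h3
      rw [Finset.sum_range_succ, Finset.sum_range_succ, h3, Pi.add_apply, Complex.add_re, h1, h2,
        Complex.ofReal_re]
  have hle := fun n => X.ae_re_le_of_tendsto (s := fun n => ∑ i ∈ Finset.range n, f i) (F := F)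
    (by
      intro m n hmn
      filter_upwards [hS] with x hx
      rw [hx, hx]
      exact Finset.sum_le_sum_of_subset_of_nonneg (Finset.range_mono hmn)
        fun i _ _ => by positivity) hF n
  filter_upwards [hS, ae_all_iff.2 hle] with x h1 h2
  rw [tendsto_zero_iff_norm_tendsto_zero]
  have hlim : Tendsto (fun n : ℕ => (1 / 2 : ℝ) ^ n * (F x).re) atTop (𝓝 0) := by
    simpa using (tendsto_pow_atTop_nhds_zero_of_lt_one (by norm_num : (0 : ℝ) ≤ 1 / 2)
      (by norm_num)).mul_const (F x).re
  refine squeeze_zero (fun n => norm_nonneg _) (fun n => ?_) hlim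
  have h3 := h2 (n + 1)
  rw [h1, Finset.sum_range_succ] at h3
  have h4 : 0 ≤ ∑ i ∈ Finset.range n, 2 ^ i * ‖a i x‖ :=
    Finset.sum_nonneg fun i _ => by positivity
  calc ‖a n x‖ = (1 / 2 : ℝ) ^ n * (2 ^ n * ‖a n x‖) := by
        rw [← mul_assoc, ← mul_pow]
        norm_num
    _ ≤ (1 / 2 : ℝ) ^ n * (F x).re := by gcongr; linarith

end KotheSpace

/-! ### The sum space as a Banach space -/

section SumSpace

variable {α : Type*} [MeasurableSpace α] {μ : Measure α} (X₀ X₁ : KotheSpace μ)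

variable {X₀ X₁} in
lemma sumNorm_le {x x₀ x₁ : α →ₘ[μ] ℂ} (h : x₀ + x₁ = x) :
    sumNorm X₀ X₁ x ≤ X₀.N x₀ + X₁.N x₁ :=
  iInf_le_of_le x₀ (iInf_le_of_le x₁ (iInf_le_of_le h le_rfl))

variable {X₀ X₁} in
lemma exists_of_sumNorm_lt {x : α →ₘ[μ] ℂ} {r : ℝ≥0∞} (h : sumNorm X₀ X₁ x < r) :
    ∃ x₀ x₁, x₀ + x₁ = x ∧ X₀.N x₀ + X₁.N x₁ < r := by
  simpa only [sumNorm, iInf_lt_iff, exists_prop] using h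

lemma sumNorm_zero : sumNorm X₀ X₁ 0 = 0 :=
  le_antisymm ((sumNorm_le (add_zero 0)).trans (by simp [KotheSpace.N_zero])) zero_le

/-- Eliminating `x₁` removes the constraint, leaving an infimum over a single variable that can be
added and scaled in `ℝ≥0∞`. -/
lemma sumNorm_eq_iInf (x : α →ₘ[μ] ℂ) :
    sumNorm X₀ X₁ x = ⨅ x₀, (X₀.N x₀ + X₁.N (x - x₀)) := by
  refine le_antisymm (le_iInf fun x₀ => sumNorm_le (add_sub_cancel x₀ x)) ?_
  refine le_iInf fun x₀ => le_iInf fun x₁ => le_iInf fun h => iInf_le_of_le x₀ ?_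
  rw [← h, add_sub_cancel_left]

lemma sumNorm_add_le (x y : α →ₘ[μ] ℂ) :
    sumNorm X₀ X₁ (x + y) ≤ sumNorm X₀ X₁ x + sumNorm X₀ X₁ y := by
  rw [sumNorm_eq_iInf X₀ X₁ x, sumNorm_eq_iInf X₀ X₁ y]
  refine ENNReal.le_iInf_add_iInf fun x₀ y₀ => ?_
  calc sumNorm X₀ X₁ (x + y) ≤ X₀.N (x₀ + y₀) + X₁.N ((x - x₀) + (y - y₀)) :=
        sumNorm_le (by abel)
    _ ≤ (X₀.N x₀ + X₀.N y₀) + (X₁.N (x - x₀) + X₁.N (y - y₀)) :=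
        add_le_add (X₀.add_le _ _) (X₁.add_le _ _)
    _ = _ := by ring

/-- An operator that is bounded on `X₀` and on `X₁` is bounded on `X₀ + X₁`. -/
lemma sumNorm_map_le (T : (α →ₘ[μ] ℂ) →ₗ[ℂ] (α →ₘ[μ] ℂ)) {K : ℝ≥0}
    (h₀ : ∀ f, X₀.N (T f) ≤ K * X₀.N f) (h₁ : ∀ f, X₁.N (T f) ≤ K * X₁.N f)
    (x : α →ₘ[μ] ℂ) : sumNorm X₀ X₁ (T x) ≤ K * sumNorm X₀ X₁ x := by
  rw [sumNorm_eq_iInf X₀ X₁ x, ENNReal.mul_iInf (fun h => absurd h ENNReal.coe_ne_top)]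
  refine le_iInf fun x₀ => ?_
  calc sumNorm X₀ X₁ (T x) ≤ X₀.N (T x₀) + X₁.N (T (x - x₀)) :=
        sumNorm_le (by rw [← map_add, add_sub_cancel])
    _ ≤ K * X₀.N x₀ + K * X₁.N (x - x₀) := add_le_add (h₀ _) (h₁ _)
    _ = _ := (mul_add _ _ _).symm

lemma sumNorm_smul (c : ℂ) (x : α →ₘ[μ] ℂ) :
    sumNorm X₀ X₁ (c • x) = ‖c‖ₑ * sumNorm X₀ X₁ x := by
  have key : ∀ (c : ℂ) x, sumNorm X₀ X₁ (c • x) ≤ ‖c‖ₑ * sumNorm X₀ X₁ x := by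
    intro c x
    rw [enorm_eq_nnnorm, ← LinearMap.lsmul_apply (R := ℂ) c x]
    refine sumNorm_map_le X₀ X₁ _ (fun f => ?_) (fun f => ?_) x
    · rw [LinearMap.lsmul_apply, X₀.smul_eq, enorm_eq_nnnorm]
    · rw [LinearMap.lsmul_apply, X₁.smul_eq, enorm_eq_nnnorm]
  refine le_antisymm (key c x) ?_
  rcases eq_or_ne c 0 with rfl | hc
  · simp
  · have hc' : ‖c‖ₑ ≠ 0 := by simpa using hc
    calc ‖c‖ₑ * sumNorm X₀ X₁ x = ‖c‖ₑ * sumNorm X₀ X₁ (c⁻¹ • c • x) := by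
          rw [inv_smul_smul₀ hc]
      _ ≤ ‖c‖ₑ * (‖c⁻¹‖ₑ * sumNorm X₀ X₁ (c • x)) := by gcongr; exact key _ _
      _ = sumNorm X₀ X₁ (c • x) := by
          rw [← mul_assoc, enorm_inv hc, ENNReal.mul_inv_cancel hc' (by simp), one_mul]

lemma sumNorm_neg (x : α →ₘ[μ] ℂ) : sumNorm X₀ X₁ (-x) = sumNorm X₀ X₁ x := by
  rw [← neg_one_smul ℂ x, sumNorm_smul]
  simp

lemma sumNorm_sub_le (x y : α →ₘ[μ] ℂ) :
    sumNorm X₀ X₁ (x - y) ≤ sumNorm X₀ X₁ x + sumNorm X₀ X₁ y := by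
  rw [sub_eq_add_neg, ← sumNorm_neg X₀ X₁ y]
  exact sumNorm_add_le X₀ X₁ _ _

/-- If the norm vanishes, `x = a n + b n` with both pieces of norm below `4⁻ⁿ`. Both then tend to
`0` almost everywhere, while their sum is constantly `x`. -/
lemma sumNorm_eq_zero_iff {x : α →ₘ[μ] ℂ} : sumNorm X₀ X₁ x = 0 ↔ x = 0 := by
  refine ⟨fun h => ?_, fun h => h ▸ sumNorm_zero X₀ X₁⟩
  have hex : ∀ n : ℕ, ∃ x₀ x₁, x₀ + x₁ = x ∧ X₀.N x₀ + X₁.N x₁ < (4⁻¹ : ℝ≥0∞) ^ n := fun n =>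
    exists_of_sumNorm_lt (h ▸ ENNReal.pow_pos (by simp) n)
  choose a b hab hN using hex
  have ha := X₀.ae_tendsto_zero a fun n => le_self_add.trans (hN n).le
  have hb := X₁.ae_tendsto_zero b fun n => le_add_self.trans (hN n).le
  refine AEEqFun.ext ?_
  have hsum : ∀ᵐ t ∂μ, ∀ n, a n t + b n t = x t := by
    rw [ae_all_iff]
    intro n
    filter_upwards [AEEqFun.coeFn_add (a n) (b n)] with t ht
    rw [← hab n, ht, Pi.add_apply]
  filter_upwards [ha, hb, hsum, AEEqFun.coeFn_zero (μ := μ) (β := ℂ) (α := α)] with t h1 h2 h3 h4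
  have h5 := h1.add h2
  simp only [h3, add_zero] at h5
  rw [h4, Pi.zero_apply]
  exact tendsto_nhds_unique tendsto_const_nhds h5

/-- The sum space `X₀ + X₁`. -/
def sumSpace : Submodule ℂ (α →ₘ[μ] ℂ) where
  carrier := {x | sumNorm X₀ X₁ x < ∞}
  zero_mem' := by simp [sumNorm_zero]
  add_mem' hx hy := (sumNorm_add_le X₀ X₁ _ _).trans_lt (ENNReal.add_lt_top.2 ⟨hx, hy⟩)
  smul_mem' c x hx := by
    change sumNorm X₀ X₁ (c • x) < ∞
    rw [sumNorm_smul]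
    exact ENNReal.mul_lt_top enorm_lt_top hx

instance : Norm (sumSpace X₀ X₁) := ⟨fun x => (sumNorm X₀ X₁ (x : α →ₘ[μ] ℂ)).toReal⟩

lemma sumSpace_norm_def (x : sumSpace X₀ X₁) : ‖x‖ = (sumNorm X₀ X₁ (x : α →ₘ[μ] ℂ)).toReal := rfl

lemma sumSpace_normedSpaceCore : NormedSpace.Core ℂ (sumSpace X₀ X₁) where
  norm_nonneg _ := ENNReal.toReal_nonneg
  norm_smul c x := by
    rw [sumSpace_norm_def, sumSpace_norm_def, Submodule.coe_smul, sumNorm_smul, ENNReal.toReal_mul,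
      toReal_enorm]
  norm_triangle x y := by
    rw [sumSpace_norm_def, sumSpace_norm_def, sumSpace_norm_def, Submodule.coe_add,
      ← ENNReal.toReal_add x.2.ne y.2.ne]
    exact ENNReal.toReal_mono (ENNReal.add_lt_top.2 ⟨x.2, y.2⟩).ne (sumNorm_add_le X₀ X₁ _ _)
  norm_eq_zero_iff x := by
    rw [sumSpace_norm_def, ENNReal.toReal_eq_zero_iff, sumNorm_eq_zero_iff]
    have hx : sumNorm X₀ X₁ (x : α →ₘ[μ] ℂ) < ∞ := x.2
    simp [hx.ne]

instance : NormedAddCommGroup (sumSpace X₀ X₁) :=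
  NormedAddCommGroup.ofCore (sumSpace_normedSpaceCore X₀ X₁)

instance : NormedSpace ℂ (sumSpace X₀ X₁) :=
  NormedSpace.ofCore (sumSpace_normedSpaceCore X₀ X₁)

lemma sumSpace_enorm (x : sumSpace X₀ X₁) : ‖x‖ₑ = sumNorm X₀ X₁ (x : α →ₘ[μ] ℂ) := by
  rw [← ofReal_norm, sumSpace_norm_def, ENNReal.ofReal_toReal x.2.ne]

lemma sumSpace_tendsto_iff {ι : Type*} {l : Filter ι} {u : ι → sumSpace X₀ X₁}
    {x : sumSpace X₀ X₁} : Tendsto u l (𝓝 x) ↔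
      Tendsto (fun i => sumNorm X₀ X₁ ((u i : α →ₘ[μ] ℂ) - x)) l (𝓝 0) := by
  rw [tendsto_iff_norm_sub_tendsto_zero, ← ENNReal.tendsto_toReal_iff
    (f := fun i => sumNorm X₀ X₁ ((u i : α →ₘ[μ] ℂ) - x)) (fun i => (u i - x).2.ne)
    ENNReal.zero_ne_top, ENNReal.toReal_zero]
  rfl

/-- An absolutely convergent series is split termwise into almost optimal pieces. The error `2⁻ⁿ`
allowed in each splitting is summable, so both series of pieces converge, in `X₀` and in `X₁`. -/
instance : CompleteSpace (sumSpace X₀ X₁) := by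
  refine NormedAddCommGroup.completeSpace_of_summable_imp_tendsto fun u hu => ?_
  have hex : ∀ n : ℕ, ∃ x₀ x₁, x₀ + x₁ = (u n : α →ₘ[μ] ℂ) ∧
      X₀.N x₀ + X₁.N x₁ < sumNorm X₀ X₁ (u n : α →ₘ[μ] ℂ) + 2⁻¹ ^ n := fun n =>
    exists_of_sumNorm_lt (ENNReal.lt_add_right (u n).2.ne (ENNReal.pow_pos (by simp) n).ne')
  choose a b hab hN using hex
  have hfin : ∑' n, (sumNorm X₀ X₁ (u n : α →ₘ[μ] ℂ) + 2⁻¹ ^ n) < ∞ := by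
    rw [ENNReal.tsum_add, ENNReal.tsum_geometric]
    refine ENNReal.add_lt_top.2 ⟨?_, by simp⟩
    simp_rw [← sumSpace_enorm, ← ofReal_norm]
    exact hu.tsum_ofReal_lt_top
  obtain ⟨A, hA, hA'⟩ := X₀.exists_tendsto_sum a
    ((ENNReal.tsum_le_tsum fun n => le_self_add.trans (hN n).le).trans_lt hfin).ne
  obtain ⟨B, hB, hB'⟩ := X₁.exists_tendsto_sum b
    ((ENNReal.tsum_le_tsum fun n => le_add_self.trans (hN n).le).trans_lt hfin).ne
  refine ⟨⟨A + B, (sumNorm_le rfl).trans_lt (ENNReal.add_lt_top.2 ⟨hA, hB⟩)⟩, ?_⟩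
  rw [sumSpace_tendsto_iff]
  refine tendsto_of_tendsto_of_tendsto_of_le_of_le tendsto_const_nhds
    (by simpa using hA'.add hB') (fun _ => zero_le) fun n => sumNorm_le ?_
  simp only [Submodule.coe_sum, ← hab, Finset.sum_add_distrib]
  abel

end SumSpace

/-! ### Calderón's space -/

section Calderon

variable {α : Type*} [MeasurableSpace α] {μ : Measure α} {X₀ X₁ : KotheSpace μ}

lemma tendsto_zero_of_le_mul {ι : Type*} {l : Filter ι} {u v : ι → ℝ≥0∞} {K : ℝ≥0}
    (hv : Tendsto v l (𝓝 0)) (h : ∀ i, u i ≤ K * v i) : Tendsto u l (𝓝 0) := by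
  refine tendsto_of_tendsto_of_tendsto_of_le_of_le tendsto_const_nhds ?_ (fun _ => zero_le) h
  simpa using ENNReal.Tendsto.const_mul hv (Or.inr (ENNReal.coe_ne_top (r := K)))

lemma tendsto_zero_of_le_add {ι : Type*} {l : Filter ι} {u v w : ι → ℝ≥0∞}
    (hv : Tendsto v l (𝓝 0)) (hw : Tendsto w l (𝓝 0)) (h : ∀ i, u i ≤ v i + w i) :
    Tendsto u l (𝓝 0) :=
  tendsto_of_tendsto_of_tendsto_of_le_of_le tendsto_const_nhds (by simpa using hv.add hw)
    (fun _ => zero_le) h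

lemma isOpen_openStrip : IsOpen openStrip :=
  (isOpen_lt continuous_const Complex.continuous_re).inter
    (isOpen_lt Complex.continuous_re continuous_const)

lemma openStrip_subset_strip : openStrip ⊆ strip := fun _ hz => ⟨hz.1.le, hz.2.le⟩

lemma strip_mem_nhds {z : ℂ} (hz : z ∈ openStrip) : strip ∈ 𝓝 z :=
  mem_of_superset (isOpen_openStrip.mem_nhds hz) openStrip_subset_strip

lemma N_le_calderonNorm_zero (g : ℂ → α →ₘ[μ] ℂ) (t : ℝ) :
    X₀.N (g (Complex.I * t)) ≤ calderonNorm X₀ X₁ g :=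
  (le_iSup (fun t : ℝ => X₀.N (g (Complex.I * t))) t).trans (le_max_left _ _)

lemma N_le_calderonNorm_one (g : ℂ → α →ₘ[μ] ℂ) (t : ℝ) :
    X₁.N (g (Complex.I * t + 1)) ≤ calderonNorm X₀ X₁ g :=
  (le_iSup (fun t : ℝ => X₁.N (g (Complex.I * t + 1))) t).trans (le_max_right _ _)

lemma calderonNorm_le {g : ℂ → α →ₘ[μ] ℂ} {C : ℝ≥0∞} (h₀ : ∀ t : ℝ, X₀.N (g (Complex.I * t)) ≤ C)
    (h₁ : ∀ t : ℝ, X₁.N (g (Complex.I * t + 1)) ≤ C) : calderonNorm X₀ X₁ g ≤ C :=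
  max_le (iSup_le h₀) (iSup_le h₁)

lemma calderonNorm_sub_le (f g : ℂ → α →ₘ[μ] ℂ) :
    calderonNorm X₀ X₁ (fun z => f z - g z) ≤ calderonNorm X₀ X₁ f + calderonNorm X₀ X₁ g :=
  calderonNorm_le
    (fun t => (X₀.N_sub_le _ _).trans
      (add_le_add (N_le_calderonNorm_zero f t) (N_le_calderonNorm_zero g t)))
    (fun t => (X₁.N_sub_le _ _).trans
      (add_le_add (N_le_calderonNorm_one f t) (N_le_calderonNorm_one g t)))

lemma HasSumDerivAt.sub {f g : ℂ → α →ₘ[μ] ℂ} {v w : α →ₘ[μ] ℂ} {z : ℂ}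
    (hf : HasSumDerivAt X₀ X₁ f v z) (hg : HasSumDerivAt X₀ X₁ g w z) :
    HasSumDerivAt X₀ X₁ (fun z => f z - g z) (v - w) z := by
  refine tendsto_zero_of_le_add hf hg fun u => ?_
  refine le_trans (le_of_eq (congrArg _ ?_)) (sumNorm_sub_le X₀ X₁ _ _)
  simp only [smul_sub]
  abel

lemma HasSumDerivAt.map {g : ℂ → α →ₘ[μ] ℂ} {v : α →ₘ[μ] ℂ} {z : ℂ}
    (hg : HasSumDerivAt X₀ X₁ g v z) (T : (α →ₘ[μ] ℂ) →ₗ[ℂ] (α →ₘ[μ] ℂ)) {K : ℝ≥0}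
    (h₀ : ∀ f, X₀.N (T f) ≤ K * X₀.N f) (h₁ : ∀ f, X₁.N (T f) ≤ K * X₁.N f) :
    HasSumDerivAt X₀ X₁ (fun z => T (g z)) (T v) z := by
  refine tendsto_zero_of_le_mul (K := K) hg fun u => ?_
  refine le_trans (le_of_eq (congrArg _ ?_)) (sumNorm_map_le X₀ X₁ T h₀ h₁ _)
  simp only [map_sub, map_smul]

/-- Needed because the selection `B` is assumed homogeneous only on the strip; the derivative at an
interior point sees nothing else. -/
lemma HasSumDerivAt.congr {f g : ℂ → α →ₘ[μ] ℂ} {v : α →ₘ[μ] ℂ} {z : ℂ}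
    (hf : HasSumDerivAt X₀ X₁ f v z) (hz : z ∈ openStrip) (h : ∀ w ∈ strip, g w = f w) :
    HasSumDerivAt X₀ X₁ g v z := by
  refine Tendsto.congr' ?_ hf
  filter_upwards [mem_nhdsWithin_of_mem_nhds (strip_mem_nhds hz)] with w hw
  rw [h w hw, h z (openStrip_subset_strip hz)]

/-- Limits are unique because `sumNorm` is definite. -/
lemma HasSumDerivAt.unique {g : ℂ → α →ₘ[μ] ℂ} {v w : α →ₘ[μ] ℂ} {z : ℂ}
    (hv : HasSumDerivAt X₀ X₁ g v z) (hw : HasSumDerivAt X₀ X₁ g w z) : v = w := by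
  have h : Tendsto (fun _ : ℂ => sumNorm X₀ X₁ (v - w)) (𝓝[≠] z) (𝓝 0) := by
    refine tendsto_zero_of_le_add hw hv fun u => ?_
    refine le_trans (le_of_eq (congrArg _ ?_)) (sumNorm_sub_le X₀ X₁ _ _)
    abel
  exact sub_eq_zero.1 ((sumNorm_eq_zero_iff X₀ X₁).1 (tendsto_nhds_unique tendsto_const_nhds h))

lemma MemCalderon.sub {f g : ℂ → α →ₘ[μ] ℂ} (hf : MemCalderon X₀ X₁ f)
    (hg : MemCalderon X₀ X₁ g) : MemCalderon X₀ X₁ (fun z => f z - g z) where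
  bounded := by
    obtain ⟨C, hC⟩ := hf.bounded
    obtain ⟨D, hD⟩ := hg.bounded
    exact ⟨C + D, fun z hz => (sumNorm_sub_le X₀ X₁ _ _).trans
      (by push_cast; exact add_le_add (hC z hz) (hD z hz))⟩
  continuousOn z hz := tendsto_zero_of_le_add (hf.continuousOn z hz) (hg.continuousOn z hz)
    fun w => by
      rw [sub_sub_sub_comm]
      exact sumNorm_sub_le X₀ X₁ _ _
  analytic z hz := by
    obtain ⟨v, hv⟩ := hf.analytic z hz
    obtain ⟨w, hw⟩ := hg.analytic z hz
    exact ⟨v - w, hv.sub hw⟩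
  bounded_zero := by
    obtain ⟨C, hC⟩ := hf.bounded_zero
    obtain ⟨D, hD⟩ := hg.bounded_zero
    exact ⟨C + D, fun t => (X₀.N_sub_le _ _).trans
      (by push_cast; exact add_le_add (hC t) (hD t))⟩
  continuous_zero t := tendsto_zero_of_le_add (hf.continuous_zero t) (hg.continuous_zero t)
    fun w => by
      rw [sub_sub_sub_comm]
      exact X₀.N_sub_le _ _
  bounded_one := by
    obtain ⟨C, hC⟩ := hf.bounded_one
    obtain ⟨D, hD⟩ := hg.bounded_one
    exact ⟨C + D, fun t => (X₁.N_sub_le _ _).trans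
      (by push_cast; exact add_le_add (hC t) (hD t))⟩
  continuous_one t := tendsto_zero_of_le_add (hf.continuous_one t) (hg.continuous_one t)
    fun w => by
      rw [sub_sub_sub_comm]
      exact X₁.N_sub_le _ _

section Map

variable (T : (α →ₘ[μ] ℂ) →ₗ[ℂ] (α →ₘ[μ] ℂ)) {K : ℝ≥0}

lemma calderonNorm_map_le (h₀ : ∀ f, X₀.N (T f) ≤ K * X₀.N f)
    (h₁ : ∀ f, X₁.N (T f) ≤ K * X₁.N f) (g : ℂ → α →ₘ[μ] ℂ) :
    calderonNorm X₀ X₁ (fun z => T (g z)) ≤ K * calderonNorm X₀ X₁ g :=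
  calderonNorm_le (fun t => (h₀ _).trans (by gcongr; exact N_le_calderonNorm_zero g t))
    (fun t => (h₁ _).trans (by gcongr; exact N_le_calderonNorm_one g t))

lemma MemCalderon.map (h₀ : ∀ f, X₀.N (T f) ≤ K * X₀.N f)
    (h₁ : ∀ f, X₁.N (T f) ≤ K * X₁.N f) {g : ℂ → α →ₘ[μ] ℂ} (hg : MemCalderon X₀ X₁ g) :
    MemCalderon X₀ X₁ (fun z => T (g z)) where
  bounded := by
    obtain ⟨C, hC⟩ := hg.bounded
    exact ⟨K * C, fun z hz => (sumNorm_map_le X₀ X₁ T h₀ h₁ _).trans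
      (by push_cast; gcongr; exact hC z hz)⟩
  continuousOn z hz := tendsto_zero_of_le_mul (hg.continuousOn z hz) fun w => by
    rw [← map_sub]
    exact sumNorm_map_le X₀ X₁ T h₀ h₁ _
  analytic z hz := by
    obtain ⟨v, hv⟩ := hg.analytic z hz
    exact ⟨T v, hv.map T h₀ h₁⟩
  bounded_zero := by
    obtain ⟨C, hC⟩ := hg.bounded_zero
    exact ⟨K * C, fun t => (h₀ _).trans (by push_cast; gcongr; exact hC t)⟩
  continuous_zero t := tendsto_zero_of_le_mul (hg.continuous_zero t) fun w => by
    rw [← map_sub]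
    exact h₀ _
  bounded_one := by
    obtain ⟨C, hC⟩ := hg.bounded_one
    exact ⟨K * C, fun t => (h₁ _).trans (by push_cast; gcongr; exact hC t)⟩
  continuous_one t := tendsto_zero_of_le_mul (hg.continuous_one t) fun w => by
    rw [← map_sub]
    exact h₁ _

end Map

/-! ### Division by a zero in Calderón's space -/

open Classical in
/-- The function `g`, regarded as a function with values in the sum space. -/
def sumLift (X₀ X₁ : KotheSpace μ) (g : ℂ → α →ₘ[μ] ℂ) (z : ℂ) : sumSpace X₀ X₁ :=
  if h : g z ∈ sumSpace X₀ X₁ then ⟨g z, h⟩ else 0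

lemma MemCalderon.coe_sumLift {g : ℂ → α →ₘ[μ] ℂ} (hg : MemCalderon X₀ X₁ g) {z : ℂ}
    (hz : z ∈ strip) : (sumLift X₀ X₁ g z : α →ₘ[μ] ℂ) = g z := by
  obtain ⟨C, hC⟩ := hg.bounded
  have h : g z ∈ sumSpace X₀ X₁ := (hC z hz).trans_lt ENNReal.coe_lt_top
  rw [sumLift, dif_pos h]

lemma MemCalderon.continuousOn_sumLift {g : ℂ → α →ₘ[μ] ℂ} (hg : MemCalderon X₀ X₁ g) :
    ContinuousOn (sumLift X₀ X₁ g) strip := by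
  intro z hz
  rw [ContinuousWithinAt, sumSpace_tendsto_iff]
  refine Tendsto.congr' ?_ (hg.continuousOn z hz)
  filter_upwards [self_mem_nhdsWithin] with w hw
  rw [hg.coe_sumLift hz, hg.coe_sumLift hw]

lemma MemCalderon.hasDerivAt_sumLift {g : ℂ → α →ₘ[μ] ℂ} (hg : MemCalderon X₀ X₁ g) {z : ℂ}
    (hz : z ∈ openStrip) {v : α →ₘ[μ] ℂ} (hv : HasSumDerivAt X₀ X₁ g v z) :
    ∃ hmem : v ∈ sumSpace X₀ X₁, HasDerivAt (sumLift X₀ X₁ g) ⟨v, hmem⟩ z := by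
  have hs : ∀ᶠ w in 𝓝[≠] z, w ∈ strip := mem_nhdsWithin_of_mem_nhds (strip_mem_nhds hz)
  have heq : ∀ w ∈ strip, (w - z)⁻¹ • (g w - g z) =
      (slope (sumLift X₀ X₁ g) z w : α →ₘ[μ] ℂ) := by
    intro w hw
    rw [slope_def_module, Submodule.coe_smul, Submodule.coe_sub, hg.coe_sumLift hw,
      hg.coe_sumLift (openStrip_subset_strip hz)]
  -- A single difference quotient at finite distance from `v` already places `v` in the sum space.
  have hmem : v ∈ sumSpace X₀ X₁ := by
    obtain ⟨w, hw, hw'⟩ := (hs.and (hv.eventually (gt_mem_nhds one_pos))).exists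
    rw [heq w hw] at hw'
    have h : (slope (sumLift X₀ X₁ g) z w : α →ₘ[μ] ℂ) - v ∈ sumSpace X₀ X₁ :=
      hw'.trans ENNReal.one_lt_top
    simpa using sub_mem (slope (sumLift X₀ X₁ g) z w).2 h
  refine ⟨hmem, ?_⟩
  rw [hasDerivAt_iff_tendsto_slope, sumSpace_tendsto_iff]
  refine Tendsto.congr' ?_ hv
  filter_upwards [hs] with w hw
  rw [heq w hw]

lemma hasSumDerivAt_of_hasDerivAt {h : ℂ → α →ₘ[μ] ℂ} {H : ℂ → sumSpace X₀ X₁}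
    {v : sumSpace X₀ X₁} {z : ℂ} (hz : z ∈ openStrip) (hH : HasDerivAt H v z)
    (heq : ∀ w ∈ strip, (H w : α →ₘ[μ] ℂ) = h w) : HasSumDerivAt X₀ X₁ h v z := by
  rw [hasDerivAt_iff_tendsto_slope, sumSpace_tendsto_iff] at hH
  refine Tendsto.congr' ?_ hH
  filter_upwards [mem_nhdsWithin_of_mem_nhds (strip_mem_nhds hz)] with w hw
  rw [slope_def_module, Submodule.coe_smul, Submodule.coe_sub, heq w hw,
    heq z (openStrip_subset_strip hz)]

/-- Splits `c s • g s - c t • g t` as `c s • (g s - g t) + (c s - c t) • g t`. The bound `K` handles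
the first term, finiteness of `X.N (g t)` the second. -/
lemma tendsto_N_smul_sub (X : KotheSpace μ) {g : ℝ → α →ₘ[μ] ℂ} {c : ℝ → ℂ} {t : ℝ}
    (hc : ContinuousAt c t) (ht : X.N (g t) < ∞) {K : ℝ≥0} (hK : ∀ s, ‖c s‖ₑ ≤ K)
    (hg : Tendsto (fun s => X.N (g s - g t)) (𝓝 t) (𝓝 0)) :
    Tendsto (fun s => X.N (c s • g s - c t • g t)) (𝓝 t) (𝓝 0) := by
  have h1 : Tendsto (fun s => X.N (c s • (g s - g t))) (𝓝 t) (𝓝 0) :=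
    tendsto_zero_of_le_mul hg fun s => by rw [X.smul_eq]; gcongr; exact hK s
  have h2 : Tendsto (fun s => X.N ((c s - c t) • g t)) (𝓝 t) (𝓝 0) := by
    simp_rw [X.smul_eq]
    have h3 : Tendsto (fun s => ‖c s - c t‖ₑ) (𝓝 t) (𝓝 0) := by
      have h4 : Tendsto (fun s => c s - c t) (𝓝 t) (𝓝 0) := by
        simpa using hc.tendsto.sub_const (c t)
      simpa using h4.enorm
    simpa using ENNReal.Tendsto.mul_const h3 (Or.inr ht.ne)
  refine tendsto_zero_of_le_add h1 h2 fun s => ?_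
  refine le_trans (le_of_eq (congrArg _ ?_)) (X.add_le _ _)
  have h3 : (c s - c t) • g t = c s • g t - c t • g t := sub_smul (c s) (c t) (g t)
  rw [smul_sub, h3]
  abel

/-- If `g` in Calderón's space vanishes at `θ`, then the quotient `g(z)/(z - θ)` is in Calderón's
space; its value at `θ` is the derivative of `g`. -/
lemma MemCalderon.exists_div {θ : ℝ} (hθ₀ : 0 < θ) (hθ₁ : θ < 1) {g : ℂ → α →ₘ[μ] ℂ}
    (hg : MemCalderon X₀ X₁ g) (hgθ : g θ = 0) {v : α →ₘ[μ] ℂ}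
    (hv : HasSumDerivAt X₀ X₁ g v θ) :
    ∃ h : ℂ → α →ₘ[μ] ℂ, MemCalderon X₀ X₁ h ∧ h θ = v ∧
      calderonNorm X₀ X₁ h ≤ ENNReal.ofReal (min θ (1 - θ))⁻¹ * calderonNorm X₀ X₁ g := by
  classical
  -- The distance from `θ` to the two boundary lines.
  set d := min θ (1 - θ) with hd
  have hd0 : 0 < d := lt_min hθ₀ (sub_pos.2 hθ₁)
  have hθ : (θ : ℂ) ∈ openStrip := ⟨by simpa using hθ₀, by simpa using hθ₁⟩
  let h : ℂ → α →ₘ[μ] ℂ := fun z => if z = θ then v else (z - θ)⁻¹ • g z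
  have hne : ∀ z : ℂ, z ≠ θ → h z = (z - θ)⁻¹ • g z := fun z hz => if_neg hz
  obtain ⟨hmem, hder⟩ := hg.hasDerivAt_sumLift hθ hv
  -- The quotient, with the value `v` at `θ`, is the divided slope of the lifted function.
  -- Continuity and analyticity can therefore be taken from the theory of `dslope`.
  have heq : ∀ z ∈ strip, ((dslope (sumLift X₀ X₁ g) (θ : ℂ) z : sumSpace X₀ X₁) : α →ₘ[μ] ℂ) = h z := by
    intro z hz
    rcases eq_or_ne z (θ : ℂ) with rfl | hzθ
    · rw [dslope_same, hder.deriv]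
      exact (if_pos rfl).symm
    · rw [dslope_of_ne _ hzθ, hne z hzθ, slope_def_module, Submodule.coe_smul, Submodule.coe_sub,
        hg.coe_sumLift hz, hg.coe_sumLift (openStrip_subset_strip hθ), hgθ, sub_zero]
  have hcont : ContinuousOn (dslope (sumLift X₀ X₁ g) θ) strip :=
    (continuousOn_dslope (strip_mem_nhds hθ)).2 ⟨hg.continuousOn_sumLift, hder.differentiableAt⟩
  -- The singularity at `θ` is removable; completeness of the sum space is used here.
  have hdiff : DifferentiableOn ℂ (dslope (sumLift X₀ X₁ g) θ) openStrip := by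
    rw [Complex.differentiableOn_dslope (isOpen_openStrip.mem_nhds hθ)]
    intro z hz
    obtain ⟨w, hw⟩ := hg.analytic z hz
    obtain ⟨_, hw'⟩ := hg.hasDerivAt_sumLift hz hw
    exact hw'.differentiableAt.differentiableWithinAt
  have hinv : ∀ z : ℂ, d ≤ ‖z - θ‖ → ‖(z - θ)⁻¹‖ₑ ≤ ENNReal.ofReal d⁻¹ := by
    intro z hz
    rw [← ofReal_norm, norm_inv]
    exact ENNReal.ofReal_le_ofReal (inv_anti₀ hd0 hz)
  have hfar₀ : ∀ t : ℝ, d ≤ ‖Complex.I * t - θ‖ := fun t =>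
    ((min_le_left _ _).trans (by simp [abs_of_pos hθ₀])).trans (Complex.abs_re_le_norm _)
  have hfar₁ : ∀ t : ℝ, d ≤ ‖Complex.I * t + 1 - θ‖ := fun t =>
    ((min_le_right _ _).trans (by simp [le_abs_self])).trans (Complex.abs_re_le_norm _)
  have hne_of : ∀ z : ℂ, d ≤ ‖z - θ‖ → z ≠ θ := by
    rintro z hz rfl
    simp only [sub_self, norm_zero] at hz
    exact absurd hz (not_le.2 hd0)
  have hb₀ : ∀ t : ℝ, X₀.N (h (Complex.I * t)) ≤
      ENNReal.ofReal d⁻¹ * X₀.N (g (Complex.I * t)) := by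
    intro t
    rw [hne _ (hne_of _ (hfar₀ t)), X₀.smul_eq]
    gcongr
    exact hinv _ (hfar₀ t)
  have hb₁ : ∀ t : ℝ, X₁.N (h (Complex.I * t + 1)) ≤
      ENNReal.ofReal d⁻¹ * X₁.N (g (Complex.I * t + 1)) := by
    intro t
    rw [hne _ (hne_of _ (hfar₁ t)), X₁.smul_eq]
    gcongr
    exact hinv _ (hfar₁ t)
  refine ⟨h, ⟨?_, ?_, ?_, ?_, ?_, ?_, ?_⟩, if_pos rfl, ?_⟩
  -- On the closed disc of radius `d` about `θ`, which lies in the strip, the quotient is bounded by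
  -- compactness. Outside it, `|z - θ|⁻¹ ≤ d⁻¹`.
  · obtain ⟨C, hC⟩ := hg.bounded
    have hsub : Metric.closedBall (θ : ℂ) d ⊆ strip := by
      intro z hz
      rw [mem_closedBall_iff_norm] at hz
      have h1 := abs_le.1 ((Complex.abs_re_le_norm _).trans hz)
      have h2 : d ≤ θ := min_le_left _ _
      have h3 : d ≤ 1 - θ := min_le_right _ _
      simp only [Complex.sub_re, Complex.ofReal_re] at h1
      exact ⟨by linarith [h1.1], by linarith [h1.2]⟩
    obtain ⟨D, hD⟩ := (isCompact_closedBall (θ : ℂ) d).exists_bound_of_continuousOn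
      (hcont.mono hsub)
    refine ⟨max D.toNNReal (d⁻¹.toNNReal * C), fun z hz => ?_⟩
    rw [ENNReal.coe_max]
    rcases le_total ‖z - θ‖ d with hzd | hzd
    · refine le_max_of_le_left ?_
      rw [← heq z hz, ← sumSpace_enorm, ← ofReal_norm]
      exact ENNReal.ofReal_le_ofReal (hD z (mem_closedBall_iff_norm.2 hzd))
    · refine le_max_of_le_right ?_
      rw [hne z (hne_of z hzd), sumNorm_smul, ENNReal.coe_mul]
      exact mul_le_mul' (hinv z hzd) (hC z hz)
  · intro z hz
    have h1 := hcont z hz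
    rw [ContinuousWithinAt, sumSpace_tendsto_iff] at h1
    refine Tendsto.congr' ?_ h1
    filter_upwards [self_mem_nhdsWithin] with w hw
    rw [heq w hw, heq z hz]
  · intro z hz
    exact ⟨_, hasSumDerivAt_of_hasDerivAt hz
      ((hdiff z hz).differentiableAt (isOpen_openStrip.mem_nhds hz)).hasDerivAt heq⟩
  · obtain ⟨C, hC⟩ := hg.bounded_zero
    exact ⟨d⁻¹.toNNReal * C, fun t => (hb₀ t).trans
      (by rw [ENNReal.coe_mul]; exact mul_le_mul' le_rfl (hC t))⟩
  · intro t
    obtain ⟨C, hC⟩ := hg.bounded_zero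
    simp_rw [fun s : ℝ => hne _ (hne_of _ (hfar₀ s))]
    refine tendsto_N_smul_sub X₀ (g := fun s : ℝ => g (Complex.I * s))
      (c := fun s : ℝ => (Complex.I * s - θ)⁻¹) (K := d⁻¹.toNNReal) ?_
      ((hC t).trans_lt ENNReal.coe_lt_top) (fun s => hinv _ (hfar₀ s)) (hg.continuous_zero t)
    exact ContinuousAt.inv₀ (by fun_prop) (sub_ne_zero.2 (hne_of _ (hfar₀ t)))
  · obtain ⟨C, hC⟩ := hg.bounded_one
    exact ⟨d⁻¹.toNNReal * C, fun t => (hb₁ t).trans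
      (by rw [ENNReal.coe_mul]; exact mul_le_mul' le_rfl (hC t))⟩
  · intro t
    obtain ⟨C, hC⟩ := hg.bounded_one
    simp_rw [fun s : ℝ => hne _ (hne_of _ (hfar₁ s))]
    refine tendsto_N_smul_sub X₁ (g := fun s : ℝ => g (Complex.I * s + 1))
      (c := fun s : ℝ => (Complex.I * s + 1 - θ)⁻¹) (K := d⁻¹.toNNReal) ?_
      ((hC t).trans_lt ENNReal.coe_lt_top) (fun s => hinv _ (hfar₁ s)) (hg.continuous_one t)
    exact ContinuousAt.inv₀ (by fun_prop) (sub_ne_zero.2 (hne_of _ (hfar₁ t)))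
  · exact calderonNorm_le
      (fun t => (hb₀ t).trans (by gcongr; exact N_le_calderonNorm_zero g t))
      (fun t => (hb₁ t).trans (by gcongr; exact N_le_calderonNorm_one g t))

/-- If `(X₀, X₁)_θ = L₂`, the derivative at `θ` maps the functions of Calderón's space that vanish
at `θ` boundedly to `L₂`. -/
lemma InterpolatesToL2.exists_eLpNorm_le {θ : ℝ} (hθ₀ : 0 < θ) (hθ₁ : θ < 1)
    (h : InterpolatesToL2 X₀ X₁ θ) :
    ∃ D : ℝ≥0, ∀ g v, MemCalderon X₀ X₁ g → g θ = 0 → HasSumDerivAt X₀ X₁ g v θ →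
      eLpNorm v 2 μ ≤ D * calderonNorm X₀ X₁ g := by
  obtain ⟨C, hC⟩ := h
  refine ⟨C * (min θ (1 - θ))⁻¹.toNNReal, fun g v hg hgθ hv => ?_⟩
  obtain ⟨f, hf, hfθ, hfN⟩ := hg.exists_div hθ₀ hθ₁ hgθ hv
  refine (hC v).2.trans ?_
  rw [ENNReal.coe_mul, mul_assoc]
  gcongr
  -- The quotient `f` is a competitor in the infimum defining the interpolation norm of `v`.
  exact (iInf₂_le_of_le f hf (iInf_le_of_le hfθ le_rfl)).trans hfN

end Calderon

/-! ### Real functions as complex functions -/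

section ToComplex

variable {𝕜 : Type*} [RCLike 𝕜]

/-- `RCLike.map` is in general only real linear. Multiplicativity holds here because the target `ℂ`
has a genuine imaginary unit. -/
lemma rclikeMap_mul (z w : 𝕜) : RCLike.map 𝕜 ℂ (z * w) = RCLike.map 𝕜 ℂ z * RCLike.map 𝕜 ℂ w := by
  apply Complex.ext <;> simp

lemma norm_rclikeMap (z : 𝕜) : ‖RCLike.map 𝕜 ℂ z‖ = ‖z‖ := by
  rw [← sq_eq_sq₀ (norm_nonneg _) (norm_nonneg _), RCLike.norm_sq_eq_def (z := z),
    Complex.sq_norm, Complex.normSq_apply]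
  simp

lemma rclikeMap_injective : Function.Injective (RCLike.map 𝕜 ℂ) := by
  rw [injective_iff_map_eq_zero]
  intro z hz
  rw [← norm_eq_zero, ← norm_rclikeMap, hz, norm_zero]

lemma rclikeMap_one : RCLike.map 𝕜 ℂ 1 = 1 := by simp

lemma rclikeMap_neg_one_pow (n : ℕ) : RCLike.map 𝕜 ℂ ((-1) ^ n) = (-1) ^ n := by
  rcases Nat.even_or_odd n with h | h
  · rw [h.neg_one_pow, h.neg_one_pow, rclikeMap_one]
  · rw [h.neg_one_pow, h.neg_one_pow, map_neg, rclikeMap_one]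

variable {α : Type*} [MeasurableSpace α] {μ : Measure α}

lemma coeFn_toComplexFun (f : α →ₘ[μ] 𝕜) :
    toComplexFun f =ᵐ[μ] fun x => RCLike.map 𝕜 ℂ (f x) :=
  AEEqFun.coeFn_comp _ _ f

lemma toComplexFun_injective : Function.Injective (toComplexFun : (α →ₘ[μ] 𝕜) → α →ₘ[μ] ℂ) := by
  intro f g h
  refine AEEqFun.ext ?_
  filter_upwards [coeFn_toComplexFun f, coeFn_toComplexFun g] with x hf hg
  rw [h] at hf
  exact rclikeMap_injective (hf.symm.trans hg)

lemma toComplexFun_add (f g : α →ₘ[μ] 𝕜) :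
    toComplexFun (f + g) = toComplexFun f + toComplexFun g := by
  refine AEEqFun.ext ?_
  filter_upwards [coeFn_toComplexFun f, coeFn_toComplexFun g, coeFn_toComplexFun (f + g),
    AEEqFun.coeFn_add f g, AEEqFun.coeFn_add (toComplexFun f) (toComplexFun g)] with x h1 h2 h3 h4 h5
  rw [h3, h4, h5, Pi.add_apply, Pi.add_apply, h1, h2, map_add]

lemma toComplexFun_sub (f g : α →ₘ[μ] 𝕜) :
    toComplexFun (f - g) = toComplexFun f - toComplexFun g := by
  rw [eq_sub_iff_add_eq, ← toComplexFun_add, sub_add_cancel]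

lemma toComplexFun_mul (f g : α →ₘ[μ] 𝕜) :
    toComplexFun (f * g) = toComplexFun f * toComplexFun g := by
  refine AEEqFun.ext ?_
  filter_upwards [coeFn_toComplexFun f, coeFn_toComplexFun g, coeFn_toComplexFun (f * g),
    AEEqFun.coeFn_mul f g, AEEqFun.coeFn_mul (toComplexFun f) (toComplexFun g)] with x h1 h2 h3 h4 h5
  rw [h3, h4, h5, Pi.mul_apply, Pi.mul_apply, h1, h2, rclikeMap_mul]

lemma toComplexFun_smul (c : 𝕜) (f : α →ₘ[μ] 𝕜) :
    toComplexFun (c • f) = RCLike.map 𝕜 ℂ c • toComplexFun f := by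
  refine AEEqFun.ext ?_
  filter_upwards [coeFn_toComplexFun f, coeFn_toComplexFun (c • f),
    AEEqFun.coeFn_smul c f, AEEqFun.coeFn_smul (RCLike.map 𝕜 ℂ c) (toComplexFun f)]
    with x h1 h2 h3 h4
  rw [h2, h3, h4, Pi.smul_apply, Pi.smul_apply, h1, smul_eq_mul, smul_eq_mul, rclikeMap_mul]

lemma eLpNorm_toComplexFun (f : α →ₘ[μ] 𝕜) (p : ℝ≥0∞) :
    eLpNorm (toComplexFun f) p μ = eLpNorm f p μ := by
  refine eLpNorm_congr_norm_ae ?_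
  filter_upwards [coeFn_toComplexFun f] with x hx
  rw [hx, norm_rclikeMap]

lemma exists_Lp_of_eLpNorm_le {u : α →ₘ[μ] 𝕜} {R : ℝ} (hR : 0 ≤ R)
    (hu : eLpNorm u 2 μ ≤ ENNReal.ofReal R) :
    ∃ v : Lp 𝕜 2 μ, (v : α →ₘ[μ] 𝕜) = u ∧ ‖v‖ ≤ R :=
  ⟨⟨u, Lp.mem_Lp_iff_eLpNorm_lt_top.2 (hu.trans_lt ENNReal.ofReal_lt_top)⟩, rfl, by
    rw [Lp.norm_def]
    exact ENNReal.toReal_le_of_le_ofReal hR hu⟩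

/-! ### Multiplication operators -/

/-- Multiplication by a function, as a linear map on `L₀(μ; ℂ)`. -/
def mulOp (m : α →ₘ[μ] ℂ) : (α →ₘ[μ] ℂ) →ₗ[ℂ] (α →ₘ[μ] ℂ) where
  toFun f := m * f
  map_add' f g := by
    refine AEEqFun.ext ?_
    filter_upwards [AEEqFun.coeFn_mul m (f + g), AEEqFun.coeFn_add f g, AEEqFun.coeFn_mul m f,
      AEEqFun.coeFn_mul m g, AEEqFun.coeFn_add (m * f) (m * g)] with x h1 h2 h3 h4 h5
    rw [h1, h5, Pi.mul_apply, Pi.add_apply, h2, h3, h4, Pi.add_apply, Pi.mul_apply, Pi.mul_apply,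
      mul_add]
  map_smul' c f := by
    refine AEEqFun.ext ?_
    filter_upwards [AEEqFun.coeFn_mul m (c • f), AEEqFun.coeFn_smul c f, AEEqFun.coeFn_mul m f,
      AEEqFun.coeFn_smul c (m * f)] with x h1 h2 h3 h4
    rw [RingHom.id_apply, h1, h4, Pi.mul_apply, Pi.smul_apply, h2, h3, Pi.smul_apply, Pi.mul_apply,
      smul_eq_mul, smul_eq_mul, mul_left_comm]

/-- Pointwise `|m f| ≤ |K f|`, so the ideal property and homogeneity of the norm suffice. -/
lemma KotheSpace.N_mulOp_le (X : KotheSpace μ) {m : α →ₘ[μ] ℂ} {K : ℝ≥0}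
    (hm : ∀ᵐ x ∂μ, ‖m x‖ ≤ K) (f : α →ₘ[μ] ℂ) : X.N (mulOp m f) ≤ K * X.N f := by
  have hK : ‖((K : ℝ) : ℂ)‖ₑ = K := by
    rw [← ofReal_norm, Complex.norm_real, Real.norm_of_nonneg K.coe_nonneg, ENNReal.ofReal_coe_nnreal]
  rw [← hK, ← X.smul_eq]
  refine X.mono _ _ ?_
  filter_upwards [hm, AEEqFun.coeFn_mul m f, AEEqFun.coeFn_smul ((K : ℝ) : ℂ) f] with x h1 h2 h3
  change ‖(m * f : α →ₘ[μ] ℂ) x‖ ≤ _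
  rw [h2, h3, Pi.mul_apply, Pi.smul_apply, smul_eq_mul, norm_mul, norm_mul, Complex.norm_real,
    Real.norm_of_nonneg K.coe_nonneg]
  gcongr

lemma ae_norm_toComplexFun_le (f : Lp 𝕜 ∞ μ) :
    ∀ᵐ x ∂μ, ‖toComplexFun (f : α →ₘ[μ] 𝕜) x‖ ≤ ‖f‖₊ := by
  have h : ∀ᵐ x ∂μ, ‖f x‖ₑ ≤ ‖f‖ₑ := by
    rw [Lp.enorm_def, eLpNorm_exponent_top]
    exact ae_le_eLpNormEssSup
  filter_upwards [h, coeFn_toComplexFun (f : α →ₘ[μ] 𝕜)] with x h1 h2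
  rw [h2, norm_rclikeMap, coe_nnnorm]
  rwa [← ofReal_norm, ← ofReal_norm, ENNReal.ofReal_le_ofReal_iff (norm_nonneg _)] at h1

end ToComplex

/-! ### Commutator estimates -/

section Commutator

variable {α : Type*} [MeasurableSpace α] {μ : Measure α} {X₀ X₁ : KotheSpace μ}
  {𝕜 : Type*} [RCLike 𝕜] {θ : ℝ} {Ω : Lp 𝕜 2 μ → (α →ₘ[μ] 𝕜)}

/-- Both sides are the derivative at `θ` of one function on the strip, since `B` is homogeneous
there. -/
lemma IsInducedByScale.map_smul (hΩ : IsInducedByScale X₀ X₁ θ Ω) (hθ₀ : 0 < θ) (hθ₁ : θ < 1)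
    (c : 𝕜) (x : Lp 𝕜 2 μ) : Ω (c • x) = c • Ω x := by
  obtain ⟨B, -, -, hsmul, -, hder⟩ := hΩ
  have hθ : (θ : ℂ) ∈ openStrip := ⟨by simpa using hθ₀, by simpa using hθ₁⟩
  refine toComplexFun_injective ?_
  rw [toComplexFun_smul]
  refine (hder (c • x)).unique (HasSumDerivAt.congr (f := fun z => RCLike.map 𝕜 ℂ c • B x z) ?_ hθ
    fun z hz => hsmul c x z hz)
  refine (hder x).map (LinearMap.lsmul ℂ (α →ₘ[μ] ℂ) (RCLike.map 𝕜 ℂ c))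
    (K := ‖RCLike.map 𝕜 ℂ c‖₊) (fun f => ?_) (fun f => ?_)
  · rw [LinearMap.lsmul_apply, X₀.smul_eq, enorm_eq_nnnorm]
  · rw [LinearMap.lsmul_apply, X₁.smul_eq, enorm_eq_nnnorm]

lemma IsInducedByScale.exists_quasilinear (hΩ : IsInducedByScale X₀ X₁ θ Ω) (hθ₀ : 0 < θ)
    (hθ₁ : θ < 1) (hX : InterpolatesToL2 X₀ X₁ θ) :
    ∃ D : ℝ≥0, ∀ x y : Lp 𝕜 2 μ,
      eLpNorm ((Ω (x + y) - Ω x - Ω y : α →ₘ[μ] 𝕜) : α → 𝕜) 2 μ ≤ D * (‖x‖ₑ + ‖y‖ₑ) := by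
  obtain ⟨B, hB, ⟨C, hC⟩, -, hval, hder⟩ := hΩ
  obtain ⟨D, hD⟩ := hX.exists_eLpNorm_le hθ₀ hθ₁
  -- `B (x + y)` contributes `C (‖x‖ + ‖y‖)`, and `B x` and `B y` together contribute the same.
  refine ⟨D * (2 * C), fun x y => ?_⟩
  have h := hD (fun z => B (x + y) z - B x z - B y z) (toComplexFun (Ω (x + y) - Ω x - Ω y))
    (((hB _).sub (hB x)).sub (hB y))
    (by simp [hval, ← toComplexFun_sub])
    (by
      rw [toComplexFun_sub, toComplexFun_sub]
      exact ((hder _).sub (hder x)).sub (hder y))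
  rw [eLpNorm_toComplexFun] at h
  refine h.trans ?_
  rw [ENNReal.coe_mul, mul_assoc]
  gcongr
  calc calderonNorm X₀ X₁ (fun z => B (x + y) z - B x z - B y z)
      ≤ calderonNorm X₀ X₁ (B (x + y)) + calderonNorm X₀ X₁ (B x) + calderonNorm X₀ X₁ (B y) :=
        (calderonNorm_sub_le _ _).trans (by gcongr; exact calderonNorm_sub_le _ _)
    _ ≤ C * (‖x‖ₑ + ‖y‖ₑ) + C * ‖x‖ₑ + C * ‖y‖ₑ :=
        add_le_add (add_le_add ((hC _).trans (by gcongr; exact enorm_add_le x y)) (hC x)) (hC y)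
    _ = ↑(2 * C) * (‖x‖ₑ + ‖y‖ₑ) := by push_cast; ring

/-- An operator that is bounded on `X₀` and on `X₁` commutes with `Ω` up to an operator that is
bounded on `L₂`. -/
lemma IsInducedByScale.exists_commutator (hΩ : IsInducedByScale X₀ X₁ θ Ω) (hθ₀ : 0 < θ)
    (hθ₁ : θ < 1) (hX : InterpolatesToL2 X₀ X₁ θ) :
    ∃ D : ℝ≥0, ∀ (T : (α →ₘ[μ] ℂ) →ₗ[ℂ] (α →ₘ[μ] ℂ)) (K : ℝ≥0),
      (∀ f, X₀.N (T f) ≤ K * X₀.N f) → (∀ f, X₁.N (T f) ≤ K * X₁.N f) →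
      ∀ (x y : Lp 𝕜 2 μ) (w : α →ₘ[μ] 𝕜),
        T (toComplexFun (x : α →ₘ[μ] 𝕜)) = toComplexFun (y : α →ₘ[μ] 𝕜) →
        T (toComplexFun (Ω x)) = toComplexFun w →
        eLpNorm ((Ω y - w : α →ₘ[μ] 𝕜) : α → 𝕜) 2 μ ≤ D * (‖y‖ₑ + K * ‖x‖ₑ) := by
  obtain ⟨B, hB, ⟨C, hC⟩, -, hval, hder⟩ := hΩ
  obtain ⟨D, hD⟩ := hX.exists_eLpNorm_le hθ₀ hθ₁
  refine ⟨D * C, fun T K h₀ h₁ x y w hy hw => ?_⟩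
  -- At `θ` this function equals `y - T x = 0`, and its derivative there is `Ω y - T (Ω x)`.
  have h := hD (fun z => B y z - T (B x z)) (toComplexFun (Ω y - w))
    ((hB y).sub ((hB x).map T h₀ h₁)) (by simp only [hval, hy, sub_self])
    (by
      rw [toComplexFun_sub, ← hw]
      exact (hder y).sub ((hder x).map T h₀ h₁))
  rw [eLpNorm_toComplexFun] at h
  refine h.trans ?_
  rw [ENNReal.coe_mul, mul_assoc]
  gcongr
  calc calderonNorm X₀ X₁ (fun z => B y z - T (B x z))
      ≤ calderonNorm X₀ X₁ (B y) + K * calderonNorm X₀ X₁ (B x) :=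
        (calderonNorm_sub_le _ _).trans (by gcongr; exact calderonNorm_map_le T h₀ h₁ (B x))
    _ ≤ C * ‖y‖ₑ + K * (C * ‖x‖ₑ) := by gcongr <;> exact hC _
    _ = C * (‖y‖ₑ + K * ‖x‖ₑ) := by ring

/-- The maps induced by an interpolation scale are centralizers. -/
lemma IsInducedByScale.isCentralizer (hΩ : IsInducedByScale X₀ X₁ θ Ω) (hθ₀ : 0 < θ)
    (hθ₁ : θ < 1) (hX : InterpolatesToL2 X₀ X₁ θ) : IsCentralizer Ω where
  homogeneous := hΩ.map_smul hθ₀ hθ₁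
  quasilinear := by
    obtain ⟨D, hD⟩ := hΩ.exists_quasilinear hθ₀ hθ₁ hX
    refine ⟨D, fun x y => exists_Lp_of_eLpNorm_le (by positivity) ((hD x y).trans (le_of_eq ?_))⟩
    rw [ENNReal.ofReal_mul D.coe_nonneg, ENNReal.ofReal_add (norm_nonneg _) (norm_nonneg _), ofReal_norm,
      ofReal_norm, ENNReal.ofReal_coe_nnreal]
  centralizer := by
    obtain ⟨D, hD⟩ := hΩ.exists_commutator hθ₀ hθ₁ hX
    -- The factor 2 arises because `‖y‖ ≤ ‖f‖ ‖x‖`, so both terms of the commutator bound are of the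
    -- same size.
    refine ⟨2 * D, fun f x y hy => exists_Lp_of_eLpNorm_le (by positivity) ?_⟩
    have hf := ae_norm_toComplexFun_le f
    have h := hD (mulOp (toComplexFun (f : α →ₘ[μ] 𝕜))) ‖f‖₊ (X₀.N_mulOp_le hf) (X₁.N_mulOp_le hf)
      x y ((f : α →ₘ[μ] 𝕜) * Ω x) (by rw [hy, toComplexFun_mul]; rfl)
      (by rw [toComplexFun_mul]; rfl)
    refine h.trans ?_
    have hyx : ‖y‖ ≤ ‖f‖ * ‖x‖ := by
      refine Lp.norm_le_mul_norm_of_ae_le_mul ?_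
      filter_upwards [hf, coeFn_toComplexFun (f : α →ₘ[μ] 𝕜), AEEqFun.coeFn_mul (f : α →ₘ[μ] 𝕜) x]
        with t h1 h2 h3
      rw [h2, norm_rclikeMap] at h1
      rw [hy, h3, Pi.mul_apply, norm_mul]
      exact mul_le_mul_of_nonneg_right h1 (norm_nonneg _)
    calc (D : ℝ≥0∞) * (‖y‖ₑ + ‖f‖₊ * ‖x‖ₑ) = ENNReal.ofReal (D * (‖y‖ + ‖f‖ * ‖x‖)) := by
          rw [ENNReal.ofReal_mul D.coe_nonneg, ENNReal.ofReal_add (norm_nonneg _) (by positivity),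
            ENNReal.ofReal_mul (norm_nonneg _), ofReal_norm, ofReal_norm, ofReal_norm,
            ENNReal.ofReal_coe_nnreal]
          rfl
      _ ≤ ENNReal.ofReal (2 * D * ‖f‖ * ‖x‖) := by
          refine ENNReal.ofReal_le_ofReal ?_
          calc (D : ℝ) * (‖y‖ + ‖f‖ * ‖x‖) ≤ D * (‖f‖ * ‖x‖ + ‖f‖ * ‖x‖) := by gcongr
            _ = 2 * D * ‖f‖ * ‖x‖ := by ring

end Commutator

/-! ### The complex structure on the twisted sum -/

namespace PairedPartition

variable {α : Type*} [MeasurableSpace α] {μ : Measure α} (S : PairedPartition μ)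

lemma flip_mem {x : α} {n : ℕ} (hn : x ∈ S.part n) : S.flip x ∈ S.part (swap n) := by
  rw [S.flip_of_mem hn]
  exact S.mapsTo n hn

lemma flip_flip (x : α) : S.flip (S.flip x) = x := by
  by_cases h : ∃ n, x ∈ S.part n
  · obtain ⟨n, hn⟩ := h
    rw [S.flip_of_mem (S.flip_mem hn), S.flip_of_mem hn, S.leftInv n hn]
  · have h' : S.flip x = x := by rw [flip, dif_neg h]
    rw [h', h']

/-- The involution `flip`, as an automorphism of the measurable space. -/
def flipEquiv : α ≃ᵐ α where
  toEquiv := Function.Involutive.toPerm S.flip S.flip_flip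
  measurable_toFun := S.measurable_flip
  measurable_invFun := S.measurable_flip

/-- `swap` changes the parity of the index, so the two exponents have odd sum. -/
lemma sign_mul_sign_flip (𝕜 : Type*) [RCLike 𝕜] {x : α} {n : ℕ} (hn : x ∈ S.part n) :
    S.sign 𝕜 x * S.sign 𝕜 (S.flip x) = -1 := by
  rw [S.sign_of_mem 𝕜 hn, S.sign_of_mem 𝕜 (S.flip_mem hn), ← pow_add]
  refine Odd.neg_one_pow ?_
  unfold swap
  split_ifs with h
  · obtain ⟨k, rfl⟩ := h
    exact ⟨k + k + 1, by ring⟩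
  · obtain ⟨k, rfl⟩ := Nat.not_even_iff_odd.1 h
    exact ⟨2 * k + 1, by omega⟩

lemma rclikeMap_sign (𝕜 : Type*) [RCLike 𝕜] (x : α) :
    RCLike.map 𝕜 ℂ (S.sign 𝕜 x) = S.sign ℂ x := by
  unfold sign
  split_ifs
  · exact rclikeMap_neg_one_pow _
  · exact rclikeMap_one

/-- The operator `ω` on the space `L₀(μ; 𝕜)`. -/
def rotate (𝕜 : Type*) [RCLike 𝕜] (f : α →ₘ[μ] 𝕜) : α →ₘ[μ] 𝕜 :=
  AEEqFun.mk (S.sign 𝕜) (S.measurable_sign 𝕜).aestronglyMeasurable *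
    f.compMeasurePreserving S.flip S.measurePreserving_flip

lemma coeFn_rotate {𝕜 : Type*} [RCLike 𝕜] (f : α →ₘ[μ] 𝕜) :
    S.rotate 𝕜 f =ᵐ[μ] fun x => S.sign 𝕜 x * f (S.flip x) := by
  filter_upwards [AEEqFun.coeFn_mul
      (AEEqFun.mk (S.sign 𝕜) (S.measurable_sign 𝕜).aestronglyMeasurable)
      (f.compMeasurePreserving S.flip S.measurePreserving_flip),
    AEEqFun.coeFn_mk (S.sign 𝕜) (S.measurable_sign 𝕜).aestronglyMeasurable,
    AEEqFun.coeFn_compMeasurePreserving f S.measurePreserving_flip] with x h1 h2 h3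
  rw [rotate, h1, Pi.mul_apply, h2, h3, Function.comp_apply]

/-- The operator `ω` on the space `L₀(μ; 𝕜)`, as a linear map. -/
def rotateLinear (𝕜 : Type*) [RCLike 𝕜] : (α →ₘ[μ] 𝕜) →ₗ[𝕜] (α →ₘ[μ] 𝕜) where
  toFun := S.rotate 𝕜
  map_add' f g := by
    refine AEEqFun.ext ?_
    filter_upwards [S.coeFn_rotate (f + g), S.coeFn_rotate f, S.coeFn_rotate g,
      AEEqFun.coeFn_add (S.rotate 𝕜 f) (S.rotate 𝕜 g),
      S.measurePreserving_flip.quasiMeasurePreserving.ae (AEEqFun.coeFn_add f g)]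
      with x h1 h2 h3 h4 h5
    rw [h1, h4, Pi.add_apply, h2, h3, h5, Pi.add_apply, mul_add]
  map_smul' c f := by
    refine AEEqFun.ext ?_
    filter_upwards [S.coeFn_rotate (c • f), S.coeFn_rotate f,
      AEEqFun.coeFn_smul c (S.rotate 𝕜 f),
      S.measurePreserving_flip.quasiMeasurePreserving.ae (AEEqFun.coeFn_smul c f)]
      with x h1 h2 h3 h4
    rw [RingHom.id_apply, h1, h3, Pi.smul_apply, h2, h4, Pi.smul_apply, smul_eq_mul, smul_eq_mul,
      mul_left_comm]

lemma rotateLinear_apply {𝕜 : Type*} [RCLike 𝕜] (f : α →ₘ[μ] 𝕜) :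
    S.rotateLinear 𝕜 f = S.rotate 𝕜 f := rfl

lemma rotate_rotate {𝕜 : Type*} [RCLike 𝕜] (f : α →ₘ[μ] 𝕜) :
    S.rotate 𝕜 (S.rotate 𝕜 f) = -f := by
  refine AEEqFun.ext ?_
  filter_upwards [S.coeFn_rotate (S.rotate 𝕜 f),
    S.measurePreserving_flip.quasiMeasurePreserving.ae (S.coeFn_rotate f),
    AEEqFun.coeFn_neg f, S.cover] with x h1 h2 h3 ⟨n, hn⟩
  rw [h1, h2, h3, S.flip_flip, ← mul_assoc, S.sign_mul_sign_flip 𝕜 hn, Pi.neg_apply, neg_one_mul]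

/-- `Ω x` lies only in `L₀`, so the commutator with `Ω` has to be formed with the extension `rotate`
of `ω` to all measurable functions. -/
lemma coe_omega {𝕜 : Type*} [RCLike 𝕜] (f : Lp 𝕜 2 μ) :
    (S.omega 𝕜 f : α →ₘ[μ] 𝕜) = S.rotate 𝕜 (f : α →ₘ[μ] 𝕜) := by
  refine AEEqFun.ext ?_
  filter_upwards [(S.memLp_rotate f).coeFn_toLp, S.coeFn_rotate (f : α →ₘ[μ] 𝕜)] with x h1 h2
  rw [h2]
  exact h1

lemma norm_omega_le {𝕜 : Type*} [RCLike 𝕜] (f : Lp 𝕜 2 μ) : ‖S.omega 𝕜 f‖ ≤ ‖f‖ := by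
  refine (ContinuousLinearMap.le_of_opNorm_le _ (LinearMap.mkContinuous_norm_le _ zero_le_one _)
    f).trans (one_mul _).le

lemma omega_omega {𝕜 : Type*} [RCLike 𝕜] (f : Lp 𝕜 2 μ) : S.omega 𝕜 (S.omega 𝕜 f) = -f := by
  refine Subtype.ext ?_
  rw [coe_omega, coe_omega, rotate_rotate, NegMemClass.coe_neg]

lemma toComplexFun_rotate {𝕜 : Type*} [RCLike 𝕜] (f : α →ₘ[μ] 𝕜) :
    toComplexFun (S.rotate 𝕜 f) = S.rotate ℂ (toComplexFun f) := by
  refine AEEqFun.ext ?_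
  filter_upwards [coeFn_toComplexFun (S.rotate 𝕜 f), S.coeFn_rotate f,
    S.coeFn_rotate (toComplexFun f),
    S.measurePreserving_flip.quasiMeasurePreserving.ae (coeFn_toComplexFun f)] with x h1 h2 h3 h4
  rw [h1, h2, h3, h4, rclikeMap_mul, S.rclikeMap_sign]

/-- The signs have modulus one, so `|ω f| = |f ∘ flip|`, and `flip` is a measure preserving
automorphism. -/
lemma N_rotate_le {X : KotheSpace μ} (hX : X.RearrangementInvariant) (f : α →ₘ[μ] ℂ) :
    X.N (S.rotate ℂ f) ≤ X.N f := by
  rw [← hX S.flipEquiv S.measurePreserving_flip f]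
  refine X.mono _ _ ?_
  filter_upwards [S.coeFn_rotate f,
    AEEqFun.coeFn_compMeasurePreserving f S.measurePreserving_flip] with x h1 h2
  refine le_of_eq ?_
  rw [h1, norm_mul, S.norm_sign, one_mul]
  exact (congrArg norm h2).symm

variable {X₀ X₁ : KotheSpace μ} {𝕜 : Type*} [RCLike 𝕜] {θ : ℝ} {Ω : Lp 𝕜 2 μ → (α →ₘ[μ] 𝕜)}

/-- The natural complex structure commutes with `Ω` up to a bounded map. -/
lemma exists_rotate_commutator (h₀ : X₀.RearrangementInvariant) (h₁ : X₁.RearrangementInvariant)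
    (hΩ : IsInducedByScale X₀ X₁ θ Ω) (hθ₀ : 0 < θ) (hθ₁ : θ < 1)
    (hX : InterpolatesToL2 X₀ X₁ θ) :
    ∃ D : ℝ, 0 ≤ D ∧ ∀ x : Lp 𝕜 2 μ, ∃ v : Lp 𝕜 2 μ,
      (v : α →ₘ[μ] 𝕜) = Ω (S.omega 𝕜 x) - S.rotate 𝕜 (Ω x) ∧ ‖v‖ ≤ D * ‖x‖ := by
  obtain ⟨D, hD⟩ := hΩ.exists_commutator hθ₀ hθ₁ hX
  refine ⟨2 * D, by positivity, fun x => exists_Lp_of_eLpNorm_le (by positivity) ?_⟩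
  have h := hD (S.rotateLinear ℂ) 1
    (fun f => by rw [ENNReal.coe_one, one_mul]; exact S.N_rotate_le h₀ f)
    (fun f => by rw [ENNReal.coe_one, one_mul]; exact S.N_rotate_le h₁ f)
    x (S.omega 𝕜 x) (S.rotate 𝕜 (Ω x))
    (by rw [coe_omega, toComplexFun_rotate]; rfl) (by rw [toComplexFun_rotate]; rfl)
  refine h.trans ?_
  have hle : ‖S.omega 𝕜 x‖ₑ ≤ ‖x‖ₑ := by
    rw [← ofReal_norm, ← ofReal_norm]
    exact ENNReal.ofReal_le_ofReal (S.norm_omega_le x)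
  calc (D : ℝ≥0∞) * (‖S.omega 𝕜 x‖ₑ + (1 : ℝ≥0) * ‖x‖ₑ) ≤ D * (‖x‖ₑ + ‖x‖ₑ) := by
        rw [ENNReal.coe_one, one_mul]
        gcongr
    _ = ENNReal.ofReal (2 * D * ‖x‖) := by
        rw [mul_assoc, ENNReal.ofReal_mul zero_le_two, ENNReal.ofReal_mul D.coe_nonneg, ofReal_norm,
          ENNReal.ofReal_coe_nnreal, ENNReal.ofReal_ofNat]
        ring

/-- The twisted sum of a map that commutes with `ω` up to a bounded map has a complex structure
compatible with `ω`. -/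
lemma exists_complexStructure (hΩ : IsCentralizer Ω) {D : ℝ} (hD₀ : 0 ≤ D)
    (hD : ∀ x : Lp 𝕜 2 μ, ∃ v : Lp 𝕜 2 μ,
      (v : α →ₘ[μ] 𝕜) = Ω (S.omega 𝕜 x) - S.rotate 𝕜 (Ω x) ∧ ‖v‖ ≤ D * ‖x‖) :
    ∃ β : twistedSum Ω hΩ →ₗ[𝕜] twistedSum Ω hΩ,
      (∃ C : ℝ, ∀ p, twistedNorm Ω hΩ (β p) ≤ C * twistedNorm Ω hΩ p) ∧
      (∀ p, β (β p) = -p) ∧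
      (∀ y, β (twistedIncl Ω hΩ y) = twistedIncl Ω hΩ (S.omega 𝕜 y)) ∧
      (∀ p, twistedQuot Ω hΩ (β p) = S.omega 𝕜 (twistedQuot Ω hΩ p)) := by
  -- For `p = (w, x)` the identity is `ωw - Ωωx = ω(w - Ωx) - (Ωωx - ωΩx)`. The first term is
  -- controlled because `ω` is a contraction, the second by the commutator bound.
  have key : ∀ p : twistedSum Ω hΩ, ∃ u : Lp 𝕜 2 μ,
      (u : α →ₘ[μ] 𝕜) = S.rotate 𝕜 p.1.1 - Ω (S.omega 𝕜 p.1.2) ∧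
      ‖u‖ ≤ ‖(⟨p.1.1 - Ω p.1.2, p.2⟩ : Lp 𝕜 2 μ)‖ + D * ‖p.1.2‖ := by
    intro p
    obtain ⟨v, hv, hvn⟩ := hD p.1.2
    refine ⟨S.omega 𝕜 ⟨p.1.1 - Ω p.1.2, p.2⟩ - v, ?_, ?_⟩
    · rw [AddSubgroupClass.coe_sub, coe_omega, hv, ← rotateLinear_apply, ← rotateLinear_apply,
        ← rotateLinear_apply, map_sub]
      abel
    · exact (norm_sub_le _ _).trans (add_le_add (S.norm_omega_le _) hvn)
  have hmem : ∀ p : twistedSum Ω hΩ,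
      (S.rotate 𝕜 p.1.1, S.omega 𝕜 p.1.2) ∈ twistedSum Ω hΩ := by
    intro p
    obtain ⟨u, hu, -⟩ := key p
    change S.rotate 𝕜 p.1.1 - Ω (S.omega 𝕜 p.1.2) ∈ Lp 𝕜 2 μ
    rw [← hu]
    exact u.2
  let β : twistedSum Ω hΩ →ₗ[𝕜] twistedSum Ω hΩ :=
    { toFun := fun p => ⟨(S.rotate 𝕜 p.1.1, S.omega 𝕜 p.1.2), hmem p⟩
      map_add' := fun p q => Subtype.ext
        (Prod.ext ((S.rotateLinear 𝕜).map_add p.1.1 q.1.1) ((S.omega 𝕜).map_add p.1.2 q.1.2))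
      map_smul' := fun c p => Subtype.ext
        (Prod.ext ((S.rotateLinear 𝕜).map_smul c p.1.1) ((S.omega 𝕜).map_smul c p.1.2)) }
  refine ⟨β, ⟨1 + D, fun p => ?_⟩, fun p => ?_, fun y => ?_, fun p => rfl⟩
  · obtain ⟨u, hu, hun⟩ := key p
    have h1 : (⟨(β p).1.1 - Ω (β p).1.2, (β p).2⟩ : Lp 𝕜 2 μ) = u := Subtype.ext hu.symm
    rw [twistedNorm, twistedNorm, h1]
    have h2 : ‖(β p).1.2‖ ≤ ‖p.1.2‖ := S.norm_omega_le _
    have h3 := mul_nonneg hD₀ (norm_nonneg (⟨p.1.1 - Ω p.1.2, p.2⟩ : Lp 𝕜 2 μ))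
    linarith
  · exact Subtype.ext (Prod.ext (S.rotate_rotate p.1.1) (S.omega_omega p.1.2))
  · exact Subtype.ext (Prod.ext (S.coe_omega y).symm ((S.omega 𝕜).map_zero))

end PairedPartition

/-! ### Existence of paired partitions -/

section Existence

/-- Consecutive intervals whose lengths agree in pairs form a paired partition. -/
def pairedPartitionOfEndpoints (I : Set ℝ) (e : ℕ → ℝ) (he : StrictMono e)
    (hI : ∀ n, Set.Ico (e n) (e (n + 1)) ⊆ I)
    (hlen : ∀ n, e (swap n + 1) - e (swap n) = e (n + 1) - e n)
    (hcover : ∀ᵐ x ∂(volume : Measure ℝ).restrict I, ∃ n, x ∈ Set.Ico (e n) (e (n + 1))) :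
    PairedPartition ((volume : Measure ℝ).restrict I) where
  part n := Set.Ico (e n) (e (n + 1))
  a n x := x + (e (swap n) - e n)
  measurableSet_part n := measurableSet_Ico
  measure_pos n := by
    rw [Measure.restrict_apply measurableSet_Ico, Set.inter_eq_left.2 (hI n), Real.volume_Ico,
      ENNReal.ofReal_pos, sub_pos]
    exact he n.lt_succ_self
  disjoint := he.monotone.pairwise_disjoint_on_Ico_succ
  cover := hcover
  mapsTo n x hx := by
    have := hlen n
    exact ⟨by linarith [hx.1], by linarith [hx.2]⟩
  leftInv n x hx := by
    rw [swap_swap]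
    ring
  measurePreserving n := by
    rw [Measure.restrict_restrict measurableSet_Ico, Measure.restrict_restrict measurableSet_Ico,
      Set.inter_eq_left.2 (hI n), Set.inter_eq_left.2 (hI (swap n))]
    -- The translation is restricted to the preimage of the target interval, which is the source
    -- interval because the two lengths agree.
    have h := (measurePreserving_add_right (volume : Measure ℝ)
      (e (swap n) - e n)).restrict_preimage (s := Set.Ico (e (swap n)) (e (swap n + 1)))
      measurableSet_Ico
    have hl : e (swap n + 1) - (e (swap n) - e n) = e (n + 1) := by linarith [hlen n]
    rwa [Set.preimage_add_const_Ico, sub_sub_cancel, hl] at h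

lemma nonempty_pairedPartition_Ici :
    Nonempty (PairedPartition ((volume : Measure ℝ).restrict (Set.Ici 0))) := by
  refine ⟨pairedPartitionOfEndpoints _ (fun n => (n : ℝ)) Nat.strictMono_cast (fun n x hx => ?_)
    (fun n => by push_cast; ring) ?_⟩
  · exact (Nat.cast_nonneg n).trans hx.1
  · filter_upwards [ae_restrict_mem measurableSet_Ici] with x hx
    exact ⟨⌊x⌋₊, Nat.floor_le hx, by push_cast; exact Nat.lt_floor_add_one x⟩

/-- The endpoints of a partition of `[0, 1)` into intervals whose lengths agree in pairs. -/
def dyadicEndpoint (n : ℕ) : ℝ :=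
  if Even n then 1 - (1 / 2) ^ (n / 2) else 1 - 3 / 4 * (1 / 2) ^ (n / 2)

lemma dyadicEndpoint_even (k : ℕ) : dyadicEndpoint (2 * k) = 1 - (1 / 2) ^ k := by
  simp [dyadicEndpoint]

lemma dyadicEndpoint_odd (k : ℕ) : dyadicEndpoint (2 * k + 1) = 1 - 3 / 4 * (1 / 2) ^ k := by
  have h : (2 * k + 1) / 2 = k := by omega
  simp [dyadicEndpoint, h]

lemma dyadicEndpoint_even_add_two (k : ℕ) :
    dyadicEndpoint (2 * k + 1 + 1) = 1 - 1 / 2 * (1 / 2) ^ k := by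
  rw [show 2 * k + 1 + 1 = 2 * (k + 1) by ring, dyadicEndpoint_even, pow_succ, mul_comm]

lemma dyadicEndpoint_strictMono : StrictMono dyadicEndpoint := by
  refine strictMono_nat_of_lt_succ fun n => ?_
  obtain ⟨k, rfl | rfl⟩ := n.even_or_odd'
  · rw [dyadicEndpoint_even, dyadicEndpoint_odd]
    have : (0 : ℝ) < (1 / 2) ^ k := by positivity
    linarith
  · rw [dyadicEndpoint_even_add_two, dyadicEndpoint_odd]
    have : (0 : ℝ) < (1 / 2) ^ k := by positivity
    linarith

/-- The intervals numbered `2k` and `2k + 1` are the two halves of `[1 - 2⁻ᵏ, 1 - 2⁻ᵏ⁻¹)`. -/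
lemma dyadicEndpoint_length_swap (n : ℕ) :
    dyadicEndpoint (swap n + 1) - dyadicEndpoint (swap n) =
      dyadicEndpoint (n + 1) - dyadicEndpoint n := by
  obtain ⟨k, rfl | rfl⟩ := n.even_or_odd'
  · have h : swap (2 * k) = 2 * k + 1 := by simp [swap]
    rw [h, dyadicEndpoint_even_add_two, dyadicEndpoint_odd, dyadicEndpoint_even]
    ring
  · have h : swap (2 * k + 1) = 2 * k := by simp [swap]
    rw [h, dyadicEndpoint_even_add_two, dyadicEndpoint_odd, dyadicEndpoint_even]
    ring

lemma dyadicEndpoint_lt_one (n : ℕ) : dyadicEndpoint n < 1 := by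
  unfold dyadicEndpoint
  split_ifs <;> simp

lemma nonempty_pairedPartition_Icc :
    Nonempty (PairedPartition ((volume : Measure ℝ).restrict (Set.Icc 0 1))) := by
  have h0 : dyadicEndpoint 0 = 0 := by simp [dyadicEndpoint]
  refine ⟨pairedPartitionOfEndpoints _ dyadicEndpoint dyadicEndpoint_strictMono (fun n x hx => ?_)
    dyadicEndpoint_length_swap ?_⟩
  · exact ⟨h0.symm.le.trans ((dyadicEndpoint_strictMono.monotone n.zero_le).trans hx.1),
      (hx.2.trans (dyadicEndpoint_lt_one _)).le⟩
  -- The point `1` lies in none of the intervals, but it is a null set.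
  · rw [← restrict_Ico_eq_restrict_Icc]
    filter_upwards [ae_restrict_mem measurableSet_Ico] with x hx
    have hex : ∃ n, x < dyadicEndpoint n := by
      obtain ⟨k, hk⟩ := exists_pow_lt_of_lt_one (sub_pos.2 hx.2) (by norm_num : (1 / 2 : ℝ) < 1)
      refine ⟨2 * k, ?_⟩
      rw [dyadicEndpoint_even]
      linarith
    classical
    -- The first endpoint beyond `x` is not the one of index `0`, which is `0 ≤ x`. Its predecessor
    -- is then the left end of the interval containing `x`.
    have hpos : Nat.find hex ≠ 0 := by
      intro h
      have h1 := Nat.find_spec hex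
      rw [h, h0] at h1
      exact absurd hx.1 (not_le.2 h1)
    obtain ⟨n, hn⟩ := Nat.exists_eq_succ_of_ne_zero hpos
    refine ⟨n, not_lt.1 (Nat.find_min hex (hn ▸ n.lt_succ_self)), ?_⟩
    have h1 := Nat.find_spec hex
    rwa [hn] at h1

/-- The singletons all have mass one, and `swap` itself serves as every `a n`. -/
lemma nonempty_pairedPartition_nat : Nonempty (PairedPartition (Measure.count : Measure ℕ)) := by
  refine ⟨⟨fun n => {n}, fun _ => swap, fun n => .singleton n, fun n => ?_, fun m n hmn => ?_, ?_,
    fun n => ?_, fun n m _ => swap_swap m, fun n => ?_⟩⟩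
  · simp
  · simpa [Function.onFun] using hmn
  · exact Eventually.of_forall fun n => ⟨n, rfl⟩
  · rintro _ rfl
    rfl
  · refine ⟨measurable_of_countable _, ?_⟩
    rw [Measure.restrict_singleton, Measure.restrict_singleton, Measure.map_smul,
      Measure.map_dirac' (measurable_of_countable _), Measure.count_singleton,
      Measure.count_singleton]

end Existence

end TwistedHilbert

end

theorem mainTheorem4 :
    (∀ {α : Type*} [MeasurableSpace α] (μ : Measure α) [SigmaFinite μ]
        (X₀ X₁ : TwistedHilbert.KotheSpace μ),
        X₀.RearrangementInvariant → X₁.RearrangementInvariant →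
      ∀ θ : ℝ, 0 < θ → θ < 1 → TwistedHilbert.InterpolatesToL2 X₀ X₁ θ →
      ∀ {𝕜 : Type*} [RCLike 𝕜] (Ω : Lp 𝕜 2 μ → (α →ₘ[μ] 𝕜)),
        TwistedHilbert.IsInducedByScale X₀ X₁ θ Ω →
      ∃ hΩ : TwistedHilbert.IsCentralizer Ω,
      ∀ S : TwistedHilbert.PairedPartition μ,
        (∀ f : Lp 𝕜 2 μ, S.omega 𝕜 (S.omega 𝕜 f) = -f) ∧
        ∃ β : TwistedHilbert.twistedSum Ω hΩ →ₗ[𝕜] TwistedHilbert.twistedSum Ω hΩ,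
          (∃ C : ℝ, ∀ p, TwistedHilbert.twistedNorm Ω hΩ (β p) ≤
            C * TwistedHilbert.twistedNorm Ω hΩ p) ∧
          (∀ p, β (β p) = -p) ∧
          (∀ y, β (TwistedHilbert.twistedIncl Ω hΩ y) =
            TwistedHilbert.twistedIncl Ω hΩ (S.omega 𝕜 y)) ∧
          (∀ p, TwistedHilbert.twistedQuot Ω hΩ (β p) =
            S.omega 𝕜 (TwistedHilbert.twistedQuot Ω hΩ p))) ∧
    Nonempty (TwistedHilbert.PairedPartition ((volume : Measure ℝ).restrict (Set.Icc 0 1))) ∧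
    Nonempty (TwistedHilbert.PairedPartition ((volume : Measure ℝ).restrict (Set.Ici 0))) ∧
    Nonempty (TwistedHilbert.PairedPartition (Measure.count : Measure ℕ)) := by
  refine ⟨?_, TwistedHilbert.nonempty_pairedPartition_Icc,
    TwistedHilbert.nonempty_pairedPartition_Ici, TwistedHilbert.nonempty_pairedPartition_nat⟩
  intro α _ μ _ X₀ X₁ h₀ h₁ θ hθ₀ hθ₁ hX 𝕜 _ Ω hΩ
  refine ⟨hΩ.isCentralizer hθ₀ hθ₁ hX, fun S => ⟨S.omega_omega, ?_⟩⟩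
  obtain ⟨D, hD₀, hD⟩ := S.exists_rotate_commutator h₀ h₁ hΩ hθ₀ hθ₁ hX
  exact S.exists_complexStructure _ hD₀ hD
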